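/- **Setting.** Let $n\ge 1$, $p\in\{3,4,5\}$, $p'=p+1$ if $p$ is odd and $p'=p+2$ if $p=4$. Let $L>0$, $\Lambda_1,\dots,\Lambda_p\in\mathbb R$, $0<\eta<1$, $\gamma_1>1$, $0<\gamma_2<1$, $\sigma_{\min}>0$, $0<\epsilon<1$, $a\in[0,\tfrac12]$, $\delta=\epsilon^a$. Let $f:\mathbb R^n\to\mathbb R$ be $p$ times continuously differentiable and bounded below, with $\|\nabla^p f(x)-\nabla^p f(y)\|\le (p-1)!\,L\,\|x-y\|$ for all $x,y$ (tensor operator norm). Write $T_p(x,s)$ for the $p$th order Taylor polynomial of $f$ about $x$ and $\lambda(x)=\lambda_{\min}[\nabla^2 f(x)]$. The SoS Taylor model at $x$ with parameter $\sigma$ is $$m_\sigma(x,s)=T_p(x,s)+\tfrac12\theta(x)\|s\|^2+\tfrac{\sigma}{p'}\|s\|^{p'},\qquad \theta(x)=\begin{cases}0,&\lambda(x)\ge\delta,\\ -\lambda(x)+\delta,&\lambda(x)\le 0,\\ \delta,&0<\lambda(x)<\delta.\end{cases}$$ A polynomial in $s$ is SoS-convex if its Hessian equals $V(s)^TV(s)$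 for some polynomial matrix $V$. **Algorithm.** Start with $x_0=0$, $\sigma^r_0=\sigma_{\min}$. At iteration $k$, terminate if $\|\nabla f(x_k)\|\le\epsilon$. Otherwise let $\bar\sigma_k$ be the smallest $\sigma$ for which $m_\sigma(x_k,\cdot)$ is SoS-convex, $\sigma_k=\max\{\bar\sigma_k,\sigma^r_k\}$, $s_k=\operatorname{argmin}_s m_{\sigma_k}(x_k,s)$, and $\rho_k=\dfrac{f(x_k)-f(x_k+s_k)}{f(x_k)-T_p(x_k,s_k)}$. If $\rho_k>\eta$ (successful iteration) set $x_{k+1}=x_k+s_k$, $\sigma^r_{k+1}=\max\{\gamma_2\sigma_k,\sigma_{\min}\}$; otherwise set $x_{k+1}=x_k$, $\sigma^r_{k+1}=\gamma_1\sigma_k$. Assume $\|\nabla^j f(x_k)\|\le\Lambda_j$ for $j=1,\dots,p$ at all iterates $x_k$. **Theorem (function value decrease in successful iterations for $3\le p\le5$).** There are constants $\hat c,\hat c_1,\hat\kappa_3,\hat\kappa_4>0$, depending only on $n,p,L,(\Lambda_j)_j,\eta,\gamma_1,\sigma_{\min}$ (so not on the iteration $k$, on $\epsilon$, $a$, $\gamma_2$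 or on $f$ otherwise), such that for every successful iteration $k\ge0$ after which the algorithm does not terminate, i.e. $\|\nabla f(x_{k+1})\|>\epsilon$: 1. (locally strongly convex) if $\lambda_{\min}[\nabla^2f(x_k)]\ge\epsilon^a$, then for $p=3,5$ $$f(x_k)-f(x_k+s_k)\ge\eta\,\hat c\,\epsilon^{a+\frac2p(1+a(p-2))},$$ and for $p=4$ $$f(x_k)-f(x_k+s_k)\ge\eta\,\hat c_1\,\epsilon^{a+\frac2{p+1}(1+\max\{1,a(p-1)\})};$$ 2. (locally nonconvex) if $\lambda_{\min}[\nabla^2f(x_k)]<0$, then $f(x_k)-f(x_k+s_k)\ge\dfrac{\eta\hat\kappa_3^2}{2(\Lambda_2+1)}\,\epsilon^2$; 3. (locally nearly strongly convex) if $0\le\lambda_{\min}[\nabla^2f(x_k)]\le\epsilon^a$, then $f(x_k)-f(x_k+s_k)\ge\dfrac{\eta\hat\kappa_4^2}{2}\,\epsilon^{2-a}$. In particular, for $a=0$ the lower bounds in case 1 are $\eta\hat c\,\epsilon^{2/p}$ for $p=3,5$ and $\eta\hat c_1\,\epsilon^{4/5}$ for $p=4$. -/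

import Mathlib

noncomputable section

/-- The space `ℝⁿ` with its Euclidean norm. -/
abbrev Rn (n : ℕ) := EuclideanSpace ℝ (Fin n)

/-- The `p`th order Taylor polynomial of `f` about `x`, evaluated at the step `s`:
`T_p(x, s) = ∑_{j ≤ p} (1 / j!) ∇ʲf(x)[s]ʲ`. -/
def taylorModel {n : ℕ} (f : Rn n → ℝ) (p : ℕ) (x s : Rn n) : ℝ :=
  ∑ j ∈ Finset.range (p + 1),
    (1 / (Nat.factorial j : ℝ)) * iteratedFDeriv ℝ j f x (fun _ => s)

/-- The Hessian matrix of `f` at `x`. -/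
def hessianMatrix {n : ℕ} (f : Rn n → ℝ) (x : Rn n) : Matrix (Fin n) (Fin n) ℝ :=
  Matrix.of fun i j =>
    iteratedFDeriv ℝ 2 f x ![EuclideanSpace.single i 1, EuclideanSpace.single j 1]

/-- The smallest (leftmost) eigenvalue of the Hessian of `f` at `x`. -/
def hessianMinEig {n : ℕ} (f : Rn n → ℝ) (x : Rn n) : ℝ :=
  sInf (spectrum ℝ (hessianMatrix f x))

/-- The order `p'` of the regularization term: `p + 1` for odd `p`, `p + 2` for even `p`. -/
def regOrder (p : ℕ) : ℕ := if Odd p then p + 1 else p + 2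

/-- The multiple of the identity that is added to the Hessian, as a function of its smallest
eigenvalue `l`: nothing in the locally strongly convex case `δ ≤ l`, `-l + δ` in the locally
nonconvex case `l ≤ 0`, and `δ` in the locally nearly strongly convex case. -/
def hessianShift (δ l : ℝ) : ℝ :=
  if δ ≤ l then 0 else if l ≤ 0 then -l + δ else δ

/-- The SoS Taylor model `m_c(x, s)` with regularization parameter `σ`. -/
def sosTaylorModel {n : ℕ} (f : Rn n → ℝ) (p : ℕ) (δ : ℝ) (x : Rn n) (σ : ℝ) (s : Rn n) : ℝ :=
  taylorModel f p x s + hessianShift δ (hessianMinEig f x) / 2 * ‖s‖ ^ 2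
    + σ / (regOrder p : ℝ) * ‖s‖ ^ regOrder p

/-- A square polynomial matrix `H` is an SoS-matrix if `H = Vᵀ V` for some (rectangular)
polynomial matrix `V`. -/
def IsSosMatrix {n : ℕ} (H : Matrix (Fin n) (Fin n) (MvPolynomial (Fin n) ℝ)) : Prop :=
  ∃ (r : ℕ) (V : Matrix (Fin r) (Fin n) (MvPolynomial (Fin n) ℝ)), H = V.transpose * V

/-- The Hessian of a polynomial, as a polynomial matrix. -/
def polyHessian {n : ℕ} (q : MvPolynomial (Fin n) ℝ) :
    Matrix (Fin n) (Fin n) (MvPolynomial (Fin n) ℝ) :=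
  Matrix.of fun i j => MvPolynomial.pderiv i (MvPolynomial.pderiv j q)

/-- `m : ℝⁿ → ℝ` is an SoS-convex polynomial: it is a polynomial function and the Hessian of
that polynomial is an SoS-matrix. -/
def IsSosConvex {n : ℕ} (m : Rn n → ℝ) : Prop :=
  ∃ q : MvPolynomial (Fin n) ℝ,
    (∀ s : Rn n, MvPolynomial.eval (fun i => s i) q = m s) ∧ IsSosMatrix (polyHessian q)

/-- The ratio of the actual decrease and the decrease predicted by the Taylor polynomial. -/
def decreaseRatio {n : ℕ} (f : Rn n → ℝ) (p : ℕ) (x s : Rn n) : ℝ :=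
  (f x - f (x + s)) / (f x - taylorModel f p x s)

/-- `f` is `p` times continuously differentiable and bounded below, and its `p`th derivative
is globally Lipschitz with constant `(p - 1)! L` in the tensor (operator) norm. -/
structure IsSmoothLip {n : ℕ} (f : Rn n → ℝ) (p : ℕ) (L : ℝ) : Prop where
  contDiff : ContDiff ℝ p f
  bddBelow : ∃ flow : ℝ, ∀ x, flow ≤ f x
  lipschitz : ∀ x y : Rn n, ‖iteratedFDeriv ℝ p f x - iteratedFDeriv ℝ p f y‖
    ≤ (Nat.factorial (p - 1) : ℝ) * L * ‖x - y‖

/-- The sequences are generated by the first `N` iterations (numbers `0, …, N - 1`) of the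
adaptive `p`th order regularization method with SoS Taylor models, with accuracy `ε`,
`δ = ε ^ a` and parameters `η, γ₁, γ₂, σmin`; none of these `N` iterations terminated.
The iterates are `x 0, …, x N`. -/
structure IsARpSosRun {n : ℕ} (f : Rn n → ℝ) (p : ℕ) (ε a η γ₁ γ₂ σmin : ℝ) (N : ℕ)
    (x s : ℕ → Rn n) (σbar σ σr : ℕ → ℝ) : Prop where
  x_zero : x 0 = 0
  σr_zero : σr 0 = σmin
  not_terminated : ∀ k < N, ε < ‖gradient f (x k)‖
  /-- `σbar k` is the smallest parameter for which the model is SoS-convex. -/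
  σbar_min : ∀ k < N, IsLeast {τ : ℝ | IsSosConvex (sosTaylorModel f p (ε ^ a) (x k) τ)} (σbar k)
  σ_eq : ∀ k < N, σ k = max (σbar k) (σr k)
  /-- `s k` is a global minimizer of the model. -/
  step : ∀ k < N, ∀ t : Rn n,
    sosTaylorModel f p (ε ^ a) (x k) (σ k) (s k) ≤ sosTaylorModel f p (ε ^ a) (x k) (σ k) t
  successful : ∀ k < N, η < decreaseRatio f p (x k) (s k) →
    x (k + 1) = x k + s k ∧ σr (k + 1) = max (γ₂ * σ k) σmin
  unsuccessful : ∀ k < N, ¬ η < decreaseRatio f p (x k) (s k) →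
    x (k + 1) = x k ∧ σr (k + 1) = γ₁ * σ k

end

/-! Write p' = 2k+2, δ = ε^a, u = ‖s‖ for the step and θ for the Hessian shift. Three estimates
carry the proof.

Regularization: σ ≤ C/δ^(2k-1) at every iteration. The shifted Hessian dominates δ times the
identity, so δ‖y‖² and σ‖s‖^(2k)‖y‖² together absorb the forms of order 3 to 5 in the model Hessian
by weighted AM-GM inequalities, each an explicit sum of squares. Hence the model is SoS-convex for σ
= 64B⁴/δ^(2k-1) (`isSosConvex_sosTaylorModel`), which bounds the smallest admissible parameter. An
unsuccessful iteration forces σ to be at most of this order (`regularization_le_of_unsuccessful`),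
and an induction over the iterations gives `IsARpSosRun.regularization_le`.

Decrease: let φ(t) be the model at ts. Since φ'(1) = 0, φ(0) - φ(1) is the integral of tφ''(t) over
[0,1]. By convexity φ'' is a nonnegative polynomial, of degree at most 4. A positive quadrature
rule, exact in degree 4 and with weight 1/96 at t = 0, bounds the integral below by φ''(0)/96 ≥
δu²/96. So the Taylor polynomial decreases by at least (δ/96 + θ/2)u² (`formSum_decrease`).

Gradient: stationarity of the model and Taylor's theorem give ε < (p-1)!L u^p + θu + σu^(2k+1) at
the next iterate (`IsSmoothLip.norm_gradient_le`).

Now either θu ≥ ε/2, and θ times the decrease is at least ηε²/8; or the other terms reach ε/2, the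
bound on σ gives u ≥ cε^β, and the decrease is at least ηδu²/96 (`IsARpSosRun.successful_decrease`).
Inserting θ = 0, θ ≤ Λ₂ + 1 or θ ≤ ε^a gives the three cases (`decrease_cases`). -/

noncomputable section

/-- A multilinear form is symmetric if it is invariant under permutations of its arguments. -/
def IsSymmForm {E : Type*} [NormedAddCommGroup E] [NormedSpace ℝ E] {j : ℕ}
    (M : ContinuousMultilinearMap ℝ (fun _ : Fin j => E) ℝ) : Prop :=
  ∀ (π : Equiv.Perm (Fin j)) (v : Fin j → E), M (v ∘ π) = M v

/-! ### Symmetric multilinear forms along lines. -/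

section Multilinear

variable {E : Type*} [NormedAddCommGroup E] [NormedSpace ℝ E]

theorem IsSymmForm.curryLeft {j : ℕ}
    {M : ContinuousMultilinearMap ℝ (fun _ : Fin (j + 1) => E) ℝ} (hM : IsSymmForm M) (y : E) :
    IsSymmForm (M.curryLeft y) := by
  intro π v
  -- `decomposeFin.symm (0, π)` is π extended to fix the first slot.
  have h := hM (Equiv.Perm.decomposeFin.symm (0, π)) (Fin.cons y v : Fin (j + 1) → E)
  simp only [ContinuousMultilinearMap.curryLeft_apply]
  rw [← h]
  congr 1
  funext i
  refine Fin.cases ?_ (fun i => ?_) i <;> simp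

theorem IsSymmForm.apply_update {j : ℕ}
    {M : ContinuousMultilinearMap ℝ (fun _ : Fin (j + 1) => E) ℝ} (hM : IsSymmForm M)
    (z y : E) (l : Fin (j + 1)) :
    M (Function.update (fun _ => z) l y) = M.curryLeft y (fun _ => z) := by
  rw [ContinuousMultilinearMap.curryLeft_apply, ← hM (Equiv.swap 0 l)]
  congr 1
  funext i
  simp only [Function.comp_apply, Function.update_apply]
  rcases eq_or_ne i 0 with rfl | hi
  · simp
  · obtain ⟨i, rfl⟩ := Fin.exists_succ_eq.2 hi
    rw [Fin.cons_succ]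
    rw [if_neg fun h => Fin.succ_ne_zero i
      ((Equiv.swap 0 l).injective (h.trans (Equiv.swap_apply_left 0 l).symm))]

theorem IsSymmForm.hasDerivAt_line {j : ℕ}
    {M : ContinuousMultilinearMap ℝ (fun _ : Fin (j + 1) => E) ℝ} (hM : IsSymmForm M)
    (s y : E) (t : ℝ) :
    HasDerivAt (fun t : ℝ => M (fun _ => s + t • y))
      ((j + 1 : ℝ) * M.curryLeft y (fun _ => s + t • y)) t := by
  have h1 : HasDerivAt (fun t : ℝ => s + t • y) y t := by
    simpa using ((hasDerivAt_id t).smul_const y).const_add s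
  have h := (HasFDerivAt.multilinear_comp (f := M) (x := t)
    (fun _ : Fin (j + 1) => h1.hasFDerivAt)).hasDerivAt
  refine h.congr_deriv ?_
  simp [ContinuousMultilinearMap.toContinuousLinearMap, hM.apply_update]

end Multilinear

/-! ### Symmetry of higher derivatives. -/

section Symmetry

variable {E : Type*} [NormedAddCommGroup E] [NormedSpace ℝ E]

theorem iteratedFDeriv_curryLeft (f : E → ℝ) (j : ℕ) (x y : E) :
    (iteratedFDeriv ℝ (j + 1) f x).curryLeft y = fderiv ℝ (iteratedFDeriv ℝ j f) x y := by
  ext v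
  rw [ContinuousMultilinearMap.curryLeft_apply, iteratedFDeriv_succ_apply_left]
  simp

theorem iteratedFDeriv_succ_succ_apply {f : E → ℝ} {j : ℕ} (hf : ContDiff ℝ (j + 2 : ℕ) f)
    (x a b : E) (v : Fin j → E) :
    iteratedFDeriv ℝ (j + 2) f x (Fin.cons a (Fin.cons b v : Fin (j + 1) → E) : Fin (j + 2) → E)
      = fderiv ℝ (fderiv ℝ (iteratedFDeriv ℝ j f)) x a b v := by
  have hd : Differentiable ℝ (fderiv ℝ (iteratedFDeriv ℝ j f)) := by
    have h1 : ContDiff ℝ (1 + 1 : ℕ) (iteratedFDeriv ℝ j f) :=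
      hf.iteratedFDeriv_right (by norm_cast; omega)
    exact (h1.fderiv_right (m := 1) (by norm_cast)).differentiable (by norm_num)
  have hd' : Differentiable ℝ (iteratedFDeriv ℝ (j + 1) f) :=
    hf.differentiable_iteratedFDeriv (by norm_cast; omega)
  have key : ∀ z, iteratedFDeriv ℝ (j + 1) f z (Fin.cons b v : Fin (j + 1) → E)
      = fderiv ℝ (iteratedFDeriv ℝ j f) z b v := fun z => by
    rw [← iteratedFDeriv_curryLeft, ContinuousMultilinearMap.curryLeft_apply]
  rw [← ContinuousMultilinearMap.curryLeft_apply, iteratedFDeriv_curryLeft]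
  have h1 := ((ContinuousMultilinearMap.apply ℝ (fun _ : Fin (j + 1) => E) ℝ
    (Fin.cons b v : Fin (j + 1) → E)).hasFDerivAt.comp x (hd' x).hasFDerivAt)
  have h2 := ((ContinuousMultilinearMap.apply ℝ (fun _ : Fin j => E) ℝ v).hasFDerivAt.comp x
    ((hd x).hasFDerivAt.clm_apply (hasFDerivAt_const b x)))
  have h3 := h1.unique (h2.congr_of_eventuallyEq (Filter.Eventually.of_forall key))
  simpa using DFunLike.congr_fun h3 a

/-- Adjacent transpositions generate the symmetric group. The swap of the first two slots is the
symmetry of a second derivative. Any other adjacent swap leaves the first slot alone, and is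
inherited by differentiating the symmetry of the derivative one order lower. -/
theorem ContDiff.isSymmForm_iteratedFDeriv {f : E → ℝ} {j : ℕ} (hf : ContDiff ℝ j f) (x : E) :
    IsSymmForm (iteratedFDeriv ℝ j f x) := by
  induction j generalizing x with
  | zero =>
    intro π v
    congr 1
    funext i
    exact i.elim0
  | succ j ih =>
    have ih := ih (hf.of_le (by norm_cast; omega))
    intro π
    have hπ : π ∈ Submonoid.closure
        (Set.range fun i : Fin j => Equiv.swap i.castSucc i.succ) := by
      rw [Equiv.Perm.mclosure_swap_castSucc_succ]; trivial
    induction hπ using Submonoid.closure_induction with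
    | one => intro v; rfl
    | mul π₁ π₂ _ _ h₁ h₂ =>
      intro v
      rw [← h₁ v, ← h₂ (v ∘ π₁)]
      rfl
    | mem π hπ =>
      obtain ⟨i, rfl⟩ := hπ
      intro v
      cases j with
      | zero => exact i.elim0
      | succ j =>
        refine Fin.cases ?_ (fun i => ?_) i
        · have e1 : v = Fin.cons (v 0) (Fin.cons (v 1) (fun l => v l.succ.succ) :
              Fin (j + 1) → E) := by
            funext l
            refine Fin.cases rfl (fun l => ?_) l
            refine Fin.cases rfl (fun l => rfl) l
          have e2 : v ∘ (Equiv.swap (Fin.castSucc 0) (Fin.succ 0) : Equiv.Perm (Fin (j + 2)))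
              = Fin.cons (v 1) (Fin.cons (v 0) (fun l => v l.succ.succ) : Fin (j + 1) → E) := by
            funext l
            refine Fin.cases (by simp) (fun l => ?_) l
            refine Fin.cases (by simp) (fun l => ?_) l
            simp only [Function.comp_apply, Fin.cons_succ]
            rw [Equiv.swap_apply_of_ne_of_ne]
            · exact Fin.succ_ne_zero _
            · exact fun h => Fin.succ_ne_zero _ (Fin.succ_injective _ h)
          rw [e2]
          conv_rhs => rw [e1]
          rw [iteratedFDeriv_succ_succ_apply hf, iteratedFDeriv_succ_succ_apply hf]
          have hs : IsSymmSndFDerivAt ℝ (iteratedFDeriv ℝ j f) x := by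
            have h1 : ContDiff ℝ 2 (iteratedFDeriv ℝ j f) :=
              hf.iteratedFDeriv_right (by norm_cast; omega)
            exact h1.contDiffAt.isSymmSndFDerivAt (by simp)
          rw [hs.eq]
        · rw [iteratedFDeriv_succ_apply_left, iteratedFDeriv_succ_apply_left]
          have e1 : (v ∘ (Equiv.swap i.succ.castSucc i.succ.succ : Equiv.Perm (Fin (j + 2)))) 0
              = v 0 := by
            rw [Function.comp_apply, Equiv.swap_apply_of_ne_of_ne]
            · exact fun h => Fin.succ_ne_zero i (Fin.castSucc_injective _ h.symm)
            · exact (Fin.succ_ne_zero _).symm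
          have e2 : Fin.tail (v ∘ (Equiv.swap i.succ.castSucc i.succ.succ :
              Equiv.Perm (Fin (j + 2)))) = Fin.tail v ∘ Equiv.swap i.castSucc i.succ := by
            funext l
            simp only [Fin.tail, Function.comp_apply]
            congr 1
            rw [← Fin.succ_castSucc]
            exact ((Fin.succ_injective _).map_swap _ _ _).symm
          rw [e1, e2]
          have hd : DifferentiableAt ℝ (iteratedFDeriv ℝ (j + 1) f) x :=
            hf.differentiable_iteratedFDeriv (by norm_cast; omega) x
          have h1 := fun w => (ContinuousMultilinearMap.apply ℝ (fun _ : Fin (j + 1) => E) ℝ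
            w).hasFDerivAt.comp x hd.hasFDerivAt
          have h3 := (h1 (Fin.tail v ∘ Equiv.swap i.castSucc i.succ)).unique
            ((h1 (Fin.tail v)).congr_of_eventuallyEq
              (Filter.Eventually.of_forall fun z => ih z _ _))
          simpa using DFunLike.congr_fun h3 (v 0)

end Symmetry

/-! ### Directional derivatives of the regularized model. -/

section Model

variable {E : Type*} [NormedAddCommGroup E] [InnerProductSpace ℝ E]

/-- The polynomial `∑_{j ≤ p} (1 / j!) D_j[s]ʲ` of a family of multilinear forms. -/
def formSum (D : ∀ j : ℕ, ContinuousMultilinearMap ℝ (fun _ : Fin j => E) ℝ) (p : ℕ) (s : E) : ℝ :=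
  ∑ j ∈ Finset.range (p + 1), (1 / (Nat.factorial j : ℝ)) * D j (fun _ => s)

/-- The family of the derivatives in direction `y`. -/
def shiftForm (D : ∀ j : ℕ, ContinuousMultilinearMap ℝ (fun _ : Fin j => E) ℝ) (y : E) (j : ℕ) :
    ContinuousMultilinearMap ℝ (fun _ : Fin j => E) ℝ :=
  (D (j + 1)).curryLeft y

/-- By symmetry, differentiating the term of order j + 1 yields j + 1 equal terms, and 1/(j+1)!
turns this factor into 1/j!. Differentiation thus only shifts the family of forms. -/
theorem hasDerivAt_formSum
    {D : ∀ j : ℕ, ContinuousMultilinearMap ℝ (fun _ : Fin j => E) ℝ} {p : ℕ}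
    (hD : ∀ j ≤ p + 1, IsSymmForm (D j)) (s y : E) (t : ℝ) :
    HasDerivAt (fun t : ℝ => formSum D (p + 1) (s + t • y))
      (formSum (shiftForm D y) p (s + t • y)) t := by
  have h : ∀ j ∈ Finset.range (p + 1), HasDerivAt
      (fun t : ℝ => (1 / (Nat.factorial (j + 1) : ℝ)) * D (j + 1) (fun _ => s + t • y))
      ((1 / (Nat.factorial j : ℝ)) * shiftForm D y j (fun _ => s + t • y)) t := by
    intro j hj
    have := ((hD (j + 1) (by simp at hj; omega)).hasDerivAt_line s y t).const_mul
      (1 / (Nat.factorial (j + 1) : ℝ))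
    refine this.congr_deriv ?_
    rw [Nat.factorial_succ, shiftForm]
    push_cast
    field_simp
  have h0 : HasDerivAt (fun t : ℝ => (1 / (Nat.factorial 0 : ℝ)) * D 0 (fun _ => s + t • y)) 0 t := by
    have : (fun t : ℝ => (1 / (Nat.factorial 0 : ℝ)) * D 0 (fun _ => s + t • y))
        = fun _ => (1 / (Nat.factorial 0 : ℝ)) * D 0 (fun _ => s) := by
      funext t
      congr 2
      funext i
      exact i.elim0
    rw [this]
    exact hasDerivAt_const _ _
  have := (HasDerivAt.fun_sum h).fun_add h0
  unfold formSum
  simp only [Finset.sum_range_succ' _ (p + 1)]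
  simpa using this

/-- A Taylor polynomial with quadratic and higher order regularization. -/
def regModel (D : ∀ j : ℕ, ContinuousMultilinearMap ℝ (fun _ : Fin j => E) ℝ) (p k : ℕ)
    (θ σ : ℝ) (s : E) : ℝ :=
  formSum D p s + θ / 2 * ‖s‖ ^ 2 + σ / (2 * k + 2) * ‖s‖ ^ (2 * k + 2)

/-- The derivative of `regModel` at `s` in direction `y`. -/
def regGrad (D : ∀ j : ℕ, ContinuousMultilinearMap ℝ (fun _ : Fin j => E) ℝ) (p k : ℕ)
    (θ σ : ℝ) (s y : E) : ℝ :=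
  formSum (shiftForm D y) (p - 1) s + θ * inner ℝ s y + σ * ‖s‖ ^ (2 * k) * inner ℝ s y

/-- The Hessian form of `regModel` at `s`. -/
def regHess (D : ∀ j : ℕ, ContinuousMultilinearMap ℝ (fun _ : Fin j => E) ℝ) (p k : ℕ)
    (θ σ : ℝ) (s y : E) : ℝ :=
  formSum (shiftForm (shiftForm D y) y) (p - 2) s + θ * ‖y‖ ^ 2
    + σ * (‖s‖ ^ (2 * k) * ‖y‖ ^ 2 + 2 * k * ‖s‖ ^ (2 * (k - 1)) * inner ℝ s y ^ 2)

theorem hasDerivAt_normSq_line (s y : E) (t : ℝ) :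
    HasDerivAt (fun t : ℝ => ‖s + t • y‖ ^ 2) (2 * inner ℝ (s + t • y) y) t := by
  have h1 : HasDerivAt (fun t : ℝ => s + t • y) y t := by
    simpa using ((hasDerivAt_id t).smul_const y).const_add s
  exact h1.norm_sq

theorem hasDerivAt_inner_line (s y : E) (t : ℝ) :
    HasDerivAt (fun t : ℝ => inner ℝ (s + t • y) y) (‖y‖ ^ 2) t := by
  have h1 : HasDerivAt (fun t : ℝ => s + t • y) y t := by
    simpa using ((hasDerivAt_id t).smul_const y).const_add s
  have := h1.inner ℝ (hasDerivAt_const t y)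
  simpa using this

theorem hasDerivAt_regModel
    {D : ∀ j : ℕ, ContinuousMultilinearMap ℝ (fun _ : Fin j => E) ℝ} {p : ℕ} (hp : 1 ≤ p)
    (hD : ∀ j ≤ p, IsSymmForm (D j)) (k : ℕ) (θ σ : ℝ) (s y : E) (t : ℝ) :
    HasDerivAt (fun t : ℝ => regModel D p k θ σ (s + t • y))
      (regGrad D p k θ σ (s + t • y) y) t := by
  obtain ⟨p, rfl⟩ := Nat.exists_eq_add_of_le' hp
  have h1 := hasDerivAt_formSum hD s y t
  have h2 := (hasDerivAt_normSq_line s y t).const_mul (θ / 2)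
  have h3 := ((hasDerivAt_normSq_line s y t).pow (k + 1)).const_mul (σ / (2 * k + 2))
  simp only [Pi.pow_def, ← pow_mul] at h3
  refine ((h1.add h2).add h3).congr_deriv ?_
  simp only [regGrad, Nat.add_sub_cancel]
  push_cast
  field_simp

theorem hasDerivAt_regGrad
    {D : ∀ j : ℕ, ContinuousMultilinearMap ℝ (fun _ : Fin j => E) ℝ} {p : ℕ} (hp : 2 ≤ p)
    (hD : ∀ j ≤ p, IsSymmForm (D j)) (k : ℕ) (θ σ : ℝ) (s y : E) (t : ℝ) :
    HasDerivAt (fun t : ℝ => regGrad D p k θ σ (s + t • y) y)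
      (regHess D p k θ σ (s + t • y) y) t := by
  obtain ⟨p, rfl⟩ := Nat.exists_eq_add_of_le' hp
  have h1 := hasDerivAt_formSum (D := shiftForm D y) (p := p)
    (fun j hj => (hD (j + 1) (by omega)).curryLeft y) s y t
  have h2 := (hasDerivAt_inner_line s y t).const_mul θ
  have h3 := (((hasDerivAt_normSq_line s y t).pow k).const_mul σ).mul (hasDerivAt_inner_line s y t)
  simp only [Pi.pow_def, ← pow_mul] at h3
  refine ((h1.add h2).add h3).congr_deriv ?_
  simp only [regHess, Nat.add_sub_cancel]
  ring

end Model

/-! ### SoS-convexity in terms of quadratic forms. -/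

section Poly

open MvPolynomial
variable {n : ℕ}

/-- Evaluation of a polynomial at a vector. -/
def evalAt (s : Rn n) (q : MvPolynomial (Fin n) ℝ) : ℝ := eval (fun i => s i) q

theorem hasDerivAt_evalAt (q : MvPolynomial (Fin n) ℝ) (s y : Rn n) (t : ℝ) :
    HasDerivAt (fun t : ℝ => evalAt (s + t • y) q)
      (∑ i, y i * evalAt (s + t • y) (pderiv i q)) t := by
  unfold evalAt
  induction q using MvPolynomial.induction_on with
  | C a => simpa using hasDerivAt_const t a
  | add p q hp hq =>
    simp only [map_add, mul_add, Finset.sum_add_distrib]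
    exact hp.add hq
  | mul_X p j hp =>
    have h1 : HasDerivAt (fun t : ℝ => (s + t • y) j) (y j) t := by
      simpa using ((hasDerivAt_id t).mul_const (y j)).const_add (s j)
    have := hp.mul h1
    simp only [map_mul, eval_X]
    refine this.congr_deriv ?_
    simp only [Derivation.leibniz, pderiv_X, smul_eq_mul, map_add, map_mul, eval_X, mul_add,
      Finset.sum_add_distrib, Finset.sum_mul]
    rw [add_comm]
    congr 1
    · rw [Finset.sum_eq_single j]
      · simp; ring
      · intro b _ hb
        simp [hb.symm]
      · simp
    · exact Finset.sum_congr rfl fun i _ => by ring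

/-- Uniqueness of derivatives along lines identifies the formal Hessian of the polynomial with the
analytic second derivative. -/
theorem sum_polyHessian_eq {m : Rn n → ℝ} {g h : Rn n → Rn n → ℝ} {q : MvPolynomial (Fin n) ℝ}
    (hq : ∀ s : Rn n, evalAt s q = m s)
    (hg : ∀ s y t, HasDerivAt (fun t : ℝ => m (s + t • y)) (g (s + t • y) y) t)
    (hh : ∀ s y t, HasDerivAt (fun t : ℝ => g (s + t • y) y) (h (s + t • y) y) t) (s y : Rn n) :
    ∑ i, ∑ j, y i * y j * evalAt s (polyHessian q i j) = h s y := by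
  have e1 : ∀ s, ∑ j, y j * evalAt s (pderiv j q) = g s y := fun s => by
    have h1 := hasDerivAt_evalAt q s y 0
    simp only [hq] at h1
    simpa using h1.unique (hg s y 0)
  have h2 : HasDerivAt (fun t : ℝ => ∑ j, y j * evalAt (s + t • y) (pderiv j q))
      (∑ j, y j * ∑ i, y i * evalAt (s + (0 : ℝ) • y) (pderiv i (pderiv j q))) 0 :=
    HasDerivAt.fun_sum fun j _ => (hasDerivAt_evalAt (pderiv j q) s y 0).const_mul (y j)
  simp only [e1] at h2
  have h3 := h2.unique (hh s y 0)
  simp only [zero_smul, add_zero] at h3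
  rw [← h3, Finset.sum_comm]
  simp only [Finset.mul_sum]
  refine Finset.sum_congr rfl fun i _ => Finset.sum_congr rfl fun j _ => ?_
  simp only [polyHessian, Matrix.of_apply]
  ring

theorem pderiv_pderiv_comm (i j : Fin n) (q : MvPolynomial (Fin n) ℝ) :
    pderiv i (pderiv j q) = pderiv j (pderiv i q) := by
  let d : Fin n → Derivation ℝ (MvPolynomial (Fin n) ℝ) (MvPolynomial (Fin n) ℝ) := pderiv
  have h : ⁅d i, d j⁆ = 0 := by
    refine MvPolynomial.derivation_ext fun l => ?_
    rw [Derivation.commutator_apply]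
    simp only [d, pderiv_X, Pi.single_apply]
    split_ifs <;> simp
  have h2 := DFunLike.congr_fun h q
  rw [Derivation.commutator_apply] at h2
  exact sub_eq_zero.1 h2

/-- Functions of `(s, y)` that are linear in `y` and polynomial in `s`. -/
def IsLinForm (g : Rn n → Rn n → ℝ) : Prop :=
  ∃ v : Fin n → MvPolynomial (Fin n) ℝ, ∀ s y, g s y = ∑ i, evalAt s (v i) * y i

/-- Sums of squares of functions of `(s, y)` that are linear in `y` and polynomial in `s`. -/
def sosForms (n : ℕ) : AddSubmonoid (Rn n → Rn n → ℝ) :=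
  AddSubmonoid.closure {Q | ∃ g, IsLinForm g ∧ Q = fun s y => g s y ^ 2}

theorem exists_matrix_of_mem_sosForms {Q : Rn n → Rn n → ℝ} (hQ : Q ∈ sosForms n) :
    ∃ (r : ℕ) (V : Matrix (Fin r) (Fin n) (MvPolynomial (Fin n) ℝ)),
      ∀ s y, Q s y = ∑ k, (∑ i, evalAt s (V k i) * y i) ^ 2 := by
  induction hQ using AddSubmonoid.closure_induction with
  | mem Q hQ =>
    obtain ⟨g, ⟨v, hv⟩, rfl⟩ := hQ
    exact ⟨1, fun _ => v, fun s y => by simp [hv]⟩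
  | zero => exact ⟨0, fun _ _ => 0, fun s y => by simp⟩
  | add Q₁ Q₂ _ _ h₁ h₂ =>
    obtain ⟨r₁, V₁, h₁⟩ := h₁
    obtain ⟨r₂, V₂, h₂⟩ := h₂
    refine ⟨r₁ + r₂, Fin.append V₁ V₂, fun s y => ?_⟩
    have e₁ := Fin.append_left V₁ V₂
    have e₂ := Fin.append_right V₁ V₂
    simp [e₁, e₂, Fin.sum_univ_add, h₁, h₂]

/-- Polarization, tested on combinations of two basis vectors. -/
theorem symm_eq_zero_of_quadForm {B : Fin n → Fin n → ℝ} (hB : ∀ i j, B i j = B j i)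
    (h : ∀ y : Rn n, ∑ i, ∑ j, y i * y j * B i j = 0) (i j : Fin n) : B i j = 0 := by
  have h1 : ∀ a b : ℝ, a * a * B i i + b * a * B j i + (a * b * B i j + b * b * B j j) = 0 := by
    intro a b
    have h2 := h (a • EuclideanSpace.single i 1 + b • EuclideanSpace.single j 1)
    simpa [add_mul, mul_add, Finset.sum_add_distrib, Pi.single_apply] using h2
  have := hB i j
  linarith [h1 1 0, h1 0 1, h1 1 1]

theorem sum_gram (r : ℕ) (V : Matrix (Fin r) (Fin n) (MvPolynomial (Fin n) ℝ)) (s y : Rn n) :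
    ∑ i, ∑ j, y i * y j * evalAt s ((V.transpose * V) i j)
      = ∑ k, (∑ i, evalAt s (V k i) * y i) ^ 2 := by
  simp_rw [sq, Finset.sum_mul_sum]
  rw [Finset.sum_comm]
  simp only [Matrix.mul_apply, Matrix.transpose_apply, map_sum, map_mul, evalAt, Finset.mul_sum]
  symm
  rw [Finset.sum_comm]
  conv_rhs => rw [Finset.sum_comm]
  refine Finset.sum_congr rfl fun i _ => ?_
  rw [Finset.sum_comm]
  refine Finset.sum_congr rfl fun j _ => Finset.sum_congr rfl fun k _ => ?_
  ring

theorem isSosConvex_of_mem_sosForms {m : Rn n → ℝ} {g h : Rn n → Rn n → ℝ} (q : MvPolynomial (Fin n) ℝ)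
    (hq : ∀ s : Rn n, evalAt s q = m s)
    (hg : ∀ s y t, HasDerivAt (fun t : ℝ => m (s + t • y)) (g (s + t • y) y) t)
    (hh : ∀ s y t, HasDerivAt (fun t : ℝ => g (s + t • y) y) (h (s + t • y) y) t)
    (hQ : h ∈ sosForms n) : IsSosConvex m := by
  obtain ⟨r, V, hV⟩ := exists_matrix_of_mem_sosForms hQ
  refine ⟨q, hq, r, V, ?_⟩
  ext1 i j
  -- Polynomials over the infinite field ℝ are determined by their values, so the matrix identity
  -- can be checked pointwise in s and then on quadratic forms in y.
  refine MvPolynomial.funext fun s' => ?_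
  obtain ⟨s, rfl⟩ : ∃ s : Rn n, (fun i => s i) = s' := ⟨WithLp.toLp 2 s', rfl⟩
  refine sub_eq_zero.1 (symm_eq_zero_of_quadForm (B := fun i j => eval (fun i => s i)
    (polyHessian q i j) - eval (fun i => s i) ((V.transpose * V) i j)) ?_ ?_ i j)
  · intro i j
    simp only [polyHessian, Matrix.of_apply, pderiv_pderiv_comm i j, Matrix.mul_apply,
      Matrix.transpose_apply, mul_comm (V _ i)]
  · intro y
    have h1 := sum_polyHessian_eq hq hg hh s y
    rw [hV] at h1
    simp only [mul_sub, Finset.sum_sub_distrib]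
    rw [sub_eq_zero]
    exact h1.trans (sum_gram r V s y).symm

theorem IsSosConvex.hess_nonneg {m : Rn n → ℝ} {g h : Rn n → Rn n → ℝ} (hm : IsSosConvex m)
    (hg : ∀ s y t, HasDerivAt (fun t : ℝ => m (s + t • y)) (g (s + t • y) y) t)
    (hh : ∀ s y t, HasDerivAt (fun t : ℝ => g (s + t • y) y) (h (s + t • y) y) t) (s y : Rn n) :
    0 ≤ h s y := by
  obtain ⟨q, hq, r, V, hV⟩ := hm
  rw [← sum_polyHessian_eq hq hg hh s y, hV]
  rw [sum_gram]
  positivity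

end Poly

/-! ### Sums of squares and weighted AM-GM inequalities. -/

section SosForms

open MvPolynomial
variable {n : ℕ}

theorem IsLinForm.smul {g : Rn n → Rn n → ℝ} (hg : IsLinForm g) (c : ℝ) :
    IsLinForm (fun s y => c * g s y) := by
  obtain ⟨v, hv⟩ := hg
  refine ⟨fun i => C c * v i, fun s y => ?_⟩
  simp [hv, evalAt, Finset.mul_sum, mul_assoc]

theorem IsLinForm.add {g h : Rn n → Rn n → ℝ} (hg : IsLinForm g) (hh : IsLinForm h) :
    IsLinForm (fun s y => g s y + h s y) := by
  obtain ⟨v, hv⟩ := hg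
  obtain ⟨w, hw⟩ := hh
  refine ⟨fun i => v i + w i, fun s y => ?_⟩
  simp [hv, hw, evalAt, add_mul, Finset.sum_add_distrib]

theorem IsLinForm.coord (i : Fin n) : IsLinForm (fun _ y : Rn n => y i) :=
  ⟨Pi.single i 1, fun s y => by
    rw [Finset.sum_eq_single i] <;> simp +contextual [evalAt]⟩

theorem IsLinForm.linear (c : Fin n → ℝ) : IsLinForm (fun _ y : Rn n => ∑ i, c i * y i) :=
  ⟨fun i => C (c i), fun s y => by simp [evalAt]⟩

theorem IsLinForm.mul_coord {g : Rn n → Rn n → ℝ} (hg : IsLinForm g) (k : Fin n) :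
    IsLinForm (fun s y => g s y * s k) := by
  obtain ⟨v, hv⟩ := hg
  refine ⟨fun i => X k * v i, fun s y => ?_⟩
  simp only [hv, evalAt, Finset.sum_mul, map_mul, eval_X]
  exact Finset.sum_congr rfl fun i _ => by ring

theorem inner_eq_sum (s y : Rn n) : inner ℝ s y = ∑ i, s i * y i := by
  simp [PiLp.inner_apply, mul_comm]

theorem IsLinForm.inner : IsLinForm (fun s y : Rn n => inner ℝ s y) :=
  ⟨fun i => X i, fun s y => by simp [evalAt, inner_eq_sum]⟩

theorem IsLinForm.normSq_mul {g : Rn n → Rn n → ℝ} (hg : IsLinForm g) :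
    IsLinForm (fun s y => ‖s‖ ^ 2 * g s y) := by
  obtain ⟨v, hv⟩ := hg
  refine ⟨fun i => (∑ k, X k ^ 2) * v i, fun s y => ?_⟩
  simp only [hv, evalAt, Finset.mul_sum, map_mul, map_sum, map_pow, eval_X,
    EuclideanSpace.real_norm_sq_eq, mul_assoc]

theorem sosForms_sq {g : Rn n → Rn n → ℝ} (hg : IsLinForm g) :
    (fun s y => g s y ^ 2) ∈ sosForms n :=
  AddSubmonoid.subset_closure ⟨g, hg, rfl⟩

theorem sosForms_smul {Q : Rn n → Rn n → ℝ} (hQ : Q ∈ sosForms n) {c : ℝ} (hc : 0 ≤ c) :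
    (fun s y => c * Q s y) ∈ sosForms n := by
  induction hQ using AddSubmonoid.closure_induction with
  | mem Q hQ =>
    obtain ⟨g, hg, rfl⟩ := hQ
    convert sosForms_sq (hg.smul √c) using 3
    rw [mul_pow, Real.sq_sqrt hc]
  | zero =>
    convert (sosForms n).zero_mem using 1
    ext s y
    simp
  | add Q₁ Q₂ _ _ h₁ h₂ =>
    convert (sosForms n).add_mem h₁ h₂ using 1
    ext s y
    simp [mul_add]

theorem sosForms_add {Q₁ Q₂ : Rn n → Rn n → ℝ} (h₁ : Q₁ ∈ sosForms n) (h₂ : Q₂ ∈ sosForms n) :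
    (fun s y => Q₁ s y + Q₂ s y) ∈ sosForms n :=
  (sosForms n).add_mem h₁ h₂

theorem sosForms_sum {ι : Type*} (t : Finset ι) {Q : ι → Rn n → Rn n → ℝ}
    (h : ∀ i ∈ t, Q i ∈ sosForms n) : (fun s y => ∑ i ∈ t, Q i s y) ∈ sosForms n := by
  convert (sosForms n).sum_mem h using 1
  ext s y
  simp

/-- AM-GM as an identity: the form is |c|/(2τ) · (τg + sign(c) h)² plus nonnegative multiples of g²
and h². -/
theorem sosForms_cross_term {g h : Rn n → Rn n → ℝ} (hg : IsLinForm g) (hh : IsLinForm h)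
    (c : ℝ) {τ : ℝ} (hτ : 0 < τ) :
    (fun s y => |c| * τ * g s y ^ 2 + c * (g s y * h s y) + |c| / τ * h s y ^ 2)
      ∈ sosForms n := by
  have h1 := sosForms_smul (sosForms_sq ((hg.smul τ).add (hh.smul (SignType.sign c))))
    (c := |c| / (2 * τ)) (by positivity)
  have h2 := sosForms_smul (sosForms_sq hg) (c := |c| * τ / 2) (by positivity)
  have h3 := sosForms_smul (sosForms_sq hh) (c := |c| / (2 * τ)) (by positivity)
  convert sosForms_add (sosForms_add h1 h2) h3 using 3 with s y
  rcases lt_trichotomy c 0 with hc | rfl | hc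
  · simp only [abs_of_neg hc, sign_neg hc, SignType.coe_neg, SignType.coe_one]
    field_simp
    ring
  · simp
  · simp only [abs_of_pos hc, sign_pos hc, SignType.coe_one]
    field_simp
    ring

theorem sosForms_cross {ι κ : Type*} [Fintype ι] [Fintype κ]
    {g : ι → Rn n → Rn n → ℝ} {h : κ → Rn n → Rn n → ℝ} (hg : ∀ i, IsLinForm (g i))
    (hh : ∀ j, IsLinForm (h j)) {c : ι → κ → ℝ} {K B α β : ℝ} (hc : ∀ i j, |c i j| ≤ K)
    -- The AM-GM weight is τ = α/B. Row sums of |c| are at most B, so the terms in g² cost at most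
    -- α; column sums are at most B, so the terms in h² cost at most B²/α ≤ β.
    (hι : K * Fintype.card ι ≤ B) (hκ : K * Fintype.card κ ≤ B) (hB : 0 < B) (hα : 0 < α)
    (hαβ : B ^ 2 ≤ α * β) :
    (fun s y => α * ∑ i, g i s y ^ 2 + ∑ i, ∑ j, c i j * (g i s y * h j s y)
      + β * ∑ j, h j s y ^ 2) ∈ sosForms n := by
  have hτ : 0 < α / B := by positivity
  have h1 := sosForms_sum Finset.univ fun i _ => sosForms_sum Finset.univ fun j _ =>
    sosForms_cross_term (hg i) (hh j) (c i j) hτ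
  have h2 := sosForms_sum Finset.univ fun i _ => sosForms_smul (sosForms_sq (hg i))
    (c := α - ∑ j, |c i j| * (α / B)) (by
      rw [← Finset.sum_mul, sub_nonneg]
      calc (∑ j, |c i j|) * (α / B) ≤ B * (α / B) := by
            gcongr
            refine (Finset.sum_le_sum fun j _ => hc i j).trans ?_
            simpa [mul_comm] using hκ
        _ = α := by field_simp)
  have h3 := sosForms_sum Finset.univ fun j _ => sosForms_smul (sosForms_sq (hh j))
    (c := β - ∑ i, |c i j| / (α / B)) (by
      rw [← Finset.sum_div, sub_nonneg, div_le_iff₀ hτ]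
      calc (∑ i, |c i j|) ≤ B := by
            refine (Finset.sum_le_sum fun i _ => hc i j).trans ?_
            simpa [mul_comm] using hι
        _ ≤ β * (α / B) := by
            rw [mul_div_assoc', le_div_iff₀ hB]
            nlinarith)
  convert sosForms_add (sosForms_add h1 h2) h3 using 3 with s y
  simp only [sub_mul, Finset.sum_sub_distrib, Finset.sum_add_distrib, Finset.sum_mul,
    ← Finset.mul_sum]
  rw [Finset.sum_comm (f := fun j i => |c i j| / (α / B) * h j s y ^ 2)]
  ring

/-- A constant positive semidefinite matrix factors as BᵀB, whose rows are the linear forms to be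
squared. -/
theorem sosForms_quad {b : Fin n → Fin n → ℝ} (hb : ∀ i j, b i j = b j i)
    (hpos : ∀ y : Rn n, 0 ≤ ∑ i, ∑ j, y i * y j * b i j) :
    (fun _ y : Rn n => ∑ i, ∑ j, y i * y j * b i j) ∈ sosForms n := by
  have hA : (Matrix.of b).PosSemidef := by
    refine Matrix.PosSemidef.of_dotProduct_mulVec_nonneg (by ext i j; simp [hb i j]) fun y => ?_
    have := hpos (WithLp.toLp 2 y)
    simp only [dotProduct, Matrix.mulVec, Finset.mul_sum, Pi.star_apply, star_trivial,
      Matrix.of_apply]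
    exact this.trans_eq (Finset.sum_congr rfl fun i _ => Finset.sum_congr rfl fun j _ => by ring)
  obtain ⟨B, hB⟩ := by
    open scoped MatrixOrder ComplexOrder in
    exact CStarAlgebra.nonneg_iff_eq_star_mul_self.1 (Matrix.nonneg_iff_posSemidef.2 hA)
  have h1 := sosForms_sum Finset.univ fun k _ => sosForms_sq (IsLinForm.linear (B k))
  convert h1 using 3 with s y
  have : ∀ i j, b i j = ∑ k, B k i * B k j := fun i j => by
    have := congrFun (congrFun hB i) j
    simpa [Matrix.mul_apply] using this
  simp_rw [sq, Finset.sum_mul_sum]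
  simp only [this, Finset.mul_sum]
  symm
  rw [Finset.sum_comm]
  refine Finset.sum_congr rfl fun i _ => ?_
  rw [Finset.sum_comm]
  refine Finset.sum_congr rfl fun j _ => Finset.sum_congr rfl fun k _ => ?_
  ring

end SosForms

/-! ### Coordinate expansions of the derivatives of order 2 to 5. -/

section Expansion

open MvPolynomial
variable {n : ℕ}

/-- The standard basis vectors. -/
abbrev stdVec (i : Fin n) : Rn n := EuclideanSpace.single i 1

theorem norm_curryLeft_le {j : ℕ} (M : ContinuousMultilinearMap ℝ (fun _ : Fin (j + 1) => Rn n) ℝ)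
    (v : Rn n) : ‖M.curryLeft v‖ ≤ ‖M‖ * ‖v‖ := by
  simpa using M.curryLeft.le_opNorm v

theorem norm_curryLeft_stdVec_le {j : ℕ}
    (M : ContinuousMultilinearMap ℝ (fun _ : Fin (j + 1) => Rn n) ℝ) (i : Fin n) :
    ‖M.curryLeft (stdVec i)‖ ≤ ‖M‖ := by
  simpa [stdVec] using norm_curryLeft_le M (stdVec i)

theorem curryLeft_expand {j : ℕ} (M : ContinuousMultilinearMap ℝ (fun _ : Fin (j + 1) => Rn n) ℝ)
    (v : Rn n) (w : Fin j → Rn n) :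
    M.curryLeft v w = ∑ i, v i * M.curryLeft (stdVec i) w := by
  have h : v = ∑ i, v i • stdVec i := by
    simpa [stdVec] using ((EuclideanSpace.basisFun (Fin n) ℝ).sum_repr v).symm
  conv_lhs => rw [h, map_sum]
  simp

theorem apply_const_eq {j : ℕ} (M : ContinuousMultilinearMap ℝ (fun _ : Fin (j + 1) => Rn n) ℝ)
    (s : Rn n) : M (fun _ => s) = M.curryLeft s (fun _ => s) := by
  rw [ContinuousMultilinearMap.curryLeft_apply]
  congr 1
  funext i
  refine Fin.cases rfl (fun i => rfl) i

theorem exists_poly_form {j : ℕ} (M : ContinuousMultilinearMap ℝ (fun _ : Fin j => Rn n) ℝ) :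
    ∃ q : MvPolynomial (Fin n) ℝ, ∀ s : Rn n, evalAt s q = M (fun _ => s) := by
  induction j with
  | zero =>
    refine ⟨C (M (fun _ => 0)), fun s => ?_⟩
    simp only [evalAt, eval_C]
    congr 1
    funext i
    exact i.elim0
  | succ j ih =>
    choose q hq using fun i => ih (M.curryLeft (stdVec i))
    refine ⟨∑ i, X i * q i, fun s => ?_⟩
    rw [apply_const_eq, curryLeft_expand]
    simp only [evalAt, map_sum, map_mul, eval_X] at hq ⊢
    simp only [hq]

theorem exists_poly_regModel
    (D : ∀ j : ℕ, ContinuousMultilinearMap ℝ (fun _ : Fin j => Rn n) ℝ) (p k : ℕ) (θ σ : ℝ) :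
    ∃ q : MvPolynomial (Fin n) ℝ, ∀ s : Rn n, evalAt s q = regModel D p k θ σ s := by
  choose q hq using fun j => exists_poly_form (D j)
  refine ⟨∑ j ∈ Finset.range (p + 1), C (1 / (Nat.factorial j : ℝ)) * q j
    + C (θ / 2) * (∑ i, X i ^ 2) + C (σ / (2 * k + 2)) * (∑ i, X i ^ 2) ^ (k + 1), fun s => ?_⟩
  have e : ‖s‖ ^ (2 * k + 2) = (‖s‖ ^ 2) ^ (k + 1) := by ring
  rw [regModel, e, EuclideanSpace.real_norm_sq_eq]
  simp only [evalAt, formSum, map_add, map_sum, map_mul, map_pow, eval_X, eval_C] at hq ⊢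
  simp only [hq]

/-- The form `M[y, y, s, …, s]`. -/
def quadForm {j : ℕ} (M : ContinuousMultilinearMap ℝ (fun _ : Fin (j + 2) => Rn n) ℝ)
    (s y : Rn n) : ℝ :=
  (M.curryLeft y).curryLeft y (fun _ => s)

theorem quadForm_expand {j : ℕ} (M : ContinuousMultilinearMap ℝ (fun _ : Fin (j + 2) => Rn n) ℝ)
    (s y : Rn n) :
    quadForm M s y = ∑ i, ∑ l, y i * y l *
      (M.curryLeft (stdVec i)).curryLeft (stdVec l) (fun _ => s) := by
  have h : ∀ (v w : Rn n) (z : Fin j → Rn n), (M.curryLeft v).curryLeft w z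
      = M.curryLeft v (Fin.cons w z : Fin (j + 1) → Rn n) := fun v w z => rfl
  rw [quadForm, h, curryLeft_expand]
  refine Finset.sum_congr rfl fun i _ => ?_
  rw [← h, curryLeft_expand, Finset.mul_sum]
  exact Finset.sum_congr rfl fun l _ => by ring

theorem sum_coord_sq (y : Rn n) : ∑ i, y i ^ 2 = ‖y‖ ^ 2 :=
  (EuclideanSpace.real_norm_sq_eq y).symm

theorem sum_coord_sq₂ (s y : Rn n) :
    ∑ i : Fin n × Fin n, (y i.1 * s i.2) ^ 2 = ‖y‖ ^ 2 * ‖s‖ ^ 2 := by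
  simp only [Fintype.sum_prod_type, mul_pow, ← sum_coord_sq, Finset.sum_mul_sum]

theorem sum_coord_sq₃ (s y : Rn n) :
    ∑ i : Fin n × Fin n × Fin n, (y i.1 * s i.2.1 * s i.2.2) ^ 2 = ‖y‖ ^ 2 * ‖s‖ ^ 4 := by
  have : ‖s‖ ^ 4 = ‖s‖ ^ 2 * ‖s‖ ^ 2 := by ring
  simp only [this, Fintype.sum_prod_type, mul_pow, ← sum_coord_sq, Finset.sum_mul_sum, mul_assoc]
  simp only [← Finset.mul_sum]

variable {K B α β : ℝ}

/-- In coordinates M[y,y,s] is a bilinear pairing of the monomials yᵢ with the monomials yⱼsₖ, whose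
squares sum to ‖y‖² and ‖y‖²‖s‖². The coefficients are at most ‖M‖, so `sosForms_cross` applies. -/
theorem sosForms_cubic (M : ContinuousMultilinearMap ℝ (fun _ : Fin 3 => Rn n) ℝ)
    (hK : ‖M‖ ≤ K) (h₁ : K * n ≤ B) (h₂ : K * n ^ 2 ≤ B) (hB : 0 < B) (hα : 0 < α)
    (hαβ : B ^ 2 ≤ α * β) :
    (fun s y => α * ‖y‖ ^ 2 + quadForm M s y + β * (‖y‖ ^ 2 * ‖s‖ ^ 2)) ∈ sosForms n := by
  have h := sosForms_cross (n := n) (ι := Fin n) (κ := Fin n × Fin n)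
    (g := fun i _ y => y i) (h := fun i s y => y i.1 * s i.2)
    (c := fun i l => ((M.curryLeft (stdVec i)).curryLeft (stdVec l.1)).curryLeft (stdVec l.2)
      (fun _ => 0)) (K := K) (B := B) (α := α) (β := β)
    (fun i => .coord i) (fun i => (IsLinForm.coord i.1).mul_coord i.2)
    (fun i l => ?_) (by simpa using h₁) (by simpa [← sq] using h₂) hB hα hαβ
  · convert h using 3 with s y
    simp only [sum_coord_sq, sum_coord_sq₂, quadForm_expand]
    simp only [Fintype.sum_prod_type]
    congr 2
    refine Finset.sum_congr rfl fun i _ => Finset.sum_congr rfl fun l _ => ?_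
    rw [apply_const_eq, curryLeft_expand, Finset.mul_sum]
    refine Finset.sum_congr rfl fun k _ => ?_
    rw [Subsingleton.elim (fun _ : Fin 0 => s) (fun _ => 0)]
    ring
  · rw [← Real.norm_eq_abs]
    refine (ContinuousMultilinearMap.le_opNorm _ _).trans ?_
    simpa using (norm_curryLeft_stdVec_le _ _).trans ((norm_curryLeft_stdVec_le _ _).trans
      ((norm_curryLeft_stdVec_le M i).trans hK))

theorem sosForms_quartic (M : ContinuousMultilinearMap ℝ (fun _ : Fin 4 => Rn n) ℝ)
    (hK : ‖M‖ ≤ K) (h₁ : K * n ≤ B) (h₂ : K * n ^ 3 ≤ B) (hB : 0 < B) (hα : 0 < α)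
    (hαβ : B ^ 2 ≤ α * β) :
    (fun s y => α * ‖y‖ ^ 2 + quadForm M s y + β * (‖y‖ ^ 2 * ‖s‖ ^ 4)) ∈ sosForms n := by
  have h := sosForms_cross (n := n) (ι := Fin n) (κ := Fin n × Fin n × Fin n)
    (g := fun i _ y => y i) (h := fun i s y => y i.1 * s i.2.1 * s i.2.2)
    (c := fun i l => (((M.curryLeft (stdVec i)).curryLeft (stdVec l.1)).curryLeft
      (stdVec l.2.1)).curryLeft (stdVec l.2.2) (fun _ => 0)) (K := K) (B := B) (α := α) (β := β)
    (fun i => .coord i) (fun i => ((IsLinForm.coord i.1).mul_coord i.2.1).mul_coord i.2.2)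
    (fun i l => ?_) (by simpa using h₁)
    (by simpa [show (n : ℝ) * (n * n) = n ^ 3 by ring] using h₂) hB hα hαβ
  · convert h using 3 with s y
    simp only [sum_coord_sq, sum_coord_sq₃, quadForm_expand]
    simp only [Fintype.sum_prod_type]
    congr 2
    refine Finset.sum_congr rfl fun i _ => Finset.sum_congr rfl fun l _ => ?_
    rw [apply_const_eq, curryLeft_expand, Finset.mul_sum]
    refine Finset.sum_congr rfl fun k _ => ?_
    rw [apply_const_eq, curryLeft_expand, Finset.mul_sum, Finset.mul_sum]
    refine Finset.sum_congr rfl fun m _ => ?_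
    rw [Subsingleton.elim (fun _ : Fin 0 => s) (fun _ => 0)]
    ring
  · rw [← Real.norm_eq_abs]
    refine (ContinuousMultilinearMap.le_opNorm _ _).trans ?_
    simpa using (norm_curryLeft_stdVec_le _ _).trans ((norm_curryLeft_stdVec_le _ _).trans
      ((norm_curryLeft_stdVec_le _ _).trans ((norm_curryLeft_stdVec_le M i).trans hK)))

/-- Here the three copies of s are split as 1 + 2 between the two copies of y, which keeps the
larger power of ‖s‖ at 4. This costs a term in ‖y‖²‖s‖², to be compensated separately. -/
theorem sosForms_quintic (M : ContinuousMultilinearMap ℝ (fun _ : Fin 5 => Rn n) ℝ)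
    (hK : ‖M‖ ≤ K) (h₁ : K * n ^ 2 ≤ B) (h₂ : K * n ^ 3 ≤ B) (hB : 0 < B) (hα : 0 < α)
    (hαβ : B ^ 2 ≤ α * β) :
    (fun s y => α * (‖y‖ ^ 2 * ‖s‖ ^ 2) + quadForm M s y + β * (‖y‖ ^ 2 * ‖s‖ ^ 4))
      ∈ sosForms n := by
  have h := sosForms_cross (n := n) (ι := Fin n × Fin n) (κ := Fin n × Fin n × Fin n)
    (g := fun i s y => y i.1 * s i.2) (h := fun i s y => y i.1 * s i.2.1 * s i.2.2)
    (c := fun i l => ((((M.curryLeft (stdVec i.1)).curryLeft (stdVec l.1)).curryLeft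
      (stdVec i.2)).curryLeft (stdVec l.2.1)).curryLeft (stdVec l.2.2) (fun _ => 0))
    (K := K) (B := B) (α := α) (β := β)
    (fun i => (IsLinForm.coord i.1).mul_coord i.2)
    (fun i => ((IsLinForm.coord i.1).mul_coord i.2.1).mul_coord i.2.2)
    (fun i l => ?_) (by simpa [← sq] using h₁)
    (by simpa [show (n : ℝ) * (n * n) = n ^ 3 by ring] using h₂) hB hα hαβ
  · convert h using 3 with s y
    simp only [sum_coord_sq₂, sum_coord_sq₃, quadForm_expand]
    simp only [Fintype.sum_prod_type]
    congr 2
    refine Finset.sum_congr rfl fun i _ => ?_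
    conv_rhs => rw [Finset.sum_comm]
    refine Finset.sum_congr rfl fun l _ => ?_
    rw [apply_const_eq, curryLeft_expand, Finset.mul_sum]
    refine Finset.sum_congr rfl fun k _ => ?_
    rw [apply_const_eq, curryLeft_expand, Finset.mul_sum, Finset.mul_sum]
    refine Finset.sum_congr rfl fun m _ => ?_
    rw [apply_const_eq, curryLeft_expand, Finset.mul_sum, Finset.mul_sum, Finset.mul_sum]
    refine Finset.sum_congr rfl fun m _ => ?_
    rw [Subsingleton.elim (fun _ : Fin 0 => s) (fun _ => 0)]
    ring
  · rw [← Real.norm_eq_abs]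
    refine (ContinuousMultilinearMap.le_opNorm _ _).trans ?_
    simpa using (norm_curryLeft_stdVec_le _ _).trans ((norm_curryLeft_stdVec_le _ _).trans
      ((norm_curryLeft_stdVec_le _ _).trans ((norm_curryLeft_stdVec_le _ _).trans
        ((norm_curryLeft_stdVec_le M i.1).trans hK))))

/-- A positive semidefinite form of degree two is a sum of squares. -/
theorem sosForms_quadForm_two {M : ContinuousMultilinearMap ℝ (fun _ : Fin 2 => Rn n) ℝ}
    (hM : IsSymmForm M) {c : ℝ} (hpos : ∀ y : Rn n, 0 ≤ quadForm M 0 y + c * ‖y‖ ^ 2) :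
    (fun s y => quadForm M s y + c * ‖y‖ ^ 2) ∈ sosForms n := by
  have e : ∀ s y : Rn n, quadForm M s y + c * ‖y‖ ^ 2 = ∑ i, ∑ l, y i * y l *
      ((M.curryLeft (stdVec i)).curryLeft (stdVec l) (fun _ => 0)
        + c * (if i = l then 1 else 0)) := by
    intro s y
    rw [quadForm_expand, Subsingleton.elim (fun _ : Fin 0 => s) (fun _ => 0), ← sum_coord_sq]
    simp only [mul_add, Finset.sum_add_distrib, mul_ite, mul_one, mul_zero, Finset.sum_ite_eq,
      Finset.mem_univ, if_true, Finset.mul_sum]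
    congr 1
    exact Finset.sum_congr rfl fun i _ => by ring
  simp only [e] at hpos ⊢
  refine sosForms_quad (fun i l => ?_) hpos
  congr 1
  · have := hM (Equiv.swap 0 1) ![stdVec i, stdVec l]
    simp only [ContinuousMultilinearMap.curryLeft_apply]
    have e1 : (Fin.cons (stdVec i) (Fin.cons (stdVec l) (fun _ => 0) : Fin 1 → Rn n) :
        Fin 2 → Rn n) = ![stdVec i, stdVec l] := by
      funext a; fin_cases a <;> rfl
    have e2 : (Fin.cons (stdVec l) (Fin.cons (stdVec i) (fun _ => 0) : Fin 1 → Rn n) :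
        Fin 2 → Rn n) = ![stdVec i, stdVec l] ∘ Equiv.swap 0 1 := by
      funext a; fin_cases a <;> simp
    rw [e1, e2, this]
  · simp only [eq_comm]

end Expansion

/-! ### SoS decomposition of the model Hessian. -/

section ModelSos

variable {n : ℕ}

theorem formSum_hess_one (D : ∀ j : ℕ, ContinuousMultilinearMap ℝ (fun _ : Fin j => Rn n) ℝ)
    (s y : Rn n) :
    formSum (shiftForm (shiftForm D y) y) 1 s = quadForm (D 2) s y + quadForm (D 3) s y := by
  simp [formSum, Finset.sum_range_succ, shiftForm, quadForm]

theorem formSum_hess_two (D : ∀ j : ℕ, ContinuousMultilinearMap ℝ (fun _ : Fin j => Rn n) ℝ)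
    (s y : Rn n) :
    formSum (shiftForm (shiftForm D y) y) 2 s = quadForm (D 2) s y + quadForm (D 3) s y
      + 1 / 2 * quadForm (D 4) s y := by
  simp [formSum, Finset.sum_range_succ, shiftForm, quadForm, Nat.factorial]

theorem formSum_hess_three (D : ∀ j : ℕ, ContinuousMultilinearMap ℝ (fun _ : Fin j => Rn n) ℝ)
    (s y : Rn n) :
    formSum (shiftForm (shiftForm D y) y) 3 s = quadForm (D 2) s y + quadForm (D 3) s y
      + 1 / 2 * quadForm (D 4) s y + 1 / 6 * quadForm (D 5) s y := by
  simp [formSum, Finset.sum_range_succ, shiftForm, quadForm, Nat.factorial]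

theorem quadForm_smul {j : ℕ} (M : ContinuousMultilinearMap ℝ (fun _ : Fin (j + 2) => Rn n) ℝ)
    (c : ℝ) (s y : Rn n) : quadForm (c • M) s y = c * quadForm M s y := by
  simp [quadForm]

theorem quadForm_zero {j : ℕ} (s y : Rn n) :
    quadForm (0 : ContinuousMultilinearMap ℝ (fun _ : Fin (j + 2) => Rn n) ℝ) s y = 0 := by
  simp [quadForm]

variable {K B δ θ : ℝ}

theorem sosForms_order_four {M₂ : ContinuousMultilinearMap ℝ (fun _ : Fin 2 => Rn n) ℝ}
    {M₃ : ContinuousMultilinearMap ℝ (fun _ : Fin 3 => Rn n) ℝ} (hM₂ : IsSymmForm M₂)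
    (h₃ : ‖M₃‖ ≤ K) (hB : 1 ≤ B) (hB₁ : K * n ≤ B) (hB₂ : K * n ^ 2 ≤ B) (hδ : 0 < δ)
    (hpos : ∀ y : Rn n, δ * ‖y‖ ^ 2 ≤ quadForm M₂ 0 y + θ * ‖y‖ ^ 2) :
    (fun s y => quadForm M₂ s y + quadForm M₃ s y + θ * ‖y‖ ^ 2
      + 64 * B ^ 4 / δ * (‖s‖ ^ 2 * ‖y‖ ^ 2 + 2 * inner ℝ s y ^ 2)) ∈ sosForms n := by
  have h1 := sosForms_quadForm_two hM₂ (c := θ - δ) fun y => by linarith [hpos y]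
  have h2 := sosForms_cubic M₃ h₃ hB₁ hB₂ (by positivity) hδ (β := 64 * B ^ 4 / δ) (by
    rw [mul_div_cancel₀ _ hδ.ne']
    nlinarith [one_le_pow₀ hB (n := 2)])
  have h3 := sosForms_smul (sosForms_sq (IsLinForm.inner (n := n)))
    (c := 64 * B ^ 4 / δ * 2) (by positivity)
  convert sosForms_add (sosForms_add h1 h2) h3 using 3 with s y
  ring

/-- The budget δ‖y‖² is split as δ/4 (cubic), δ/4 (quartic) and δ/2 (compensation), and 64 B⁴/δ³ ·
‖s‖⁴‖y‖² as 16 (quartic), 16 (quintic) and 32 (compensation). -/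
theorem sosForms_order_six {M₂ : ContinuousMultilinearMap ℝ (fun _ : Fin 2 => Rn n) ℝ}
    {M₃ : ContinuousMultilinearMap ℝ (fun _ : Fin 3 => Rn n) ℝ}
    {M₄ : ContinuousMultilinearMap ℝ (fun _ : Fin 4 => Rn n) ℝ}
    {M₅ : ContinuousMultilinearMap ℝ (fun _ : Fin 5 => Rn n) ℝ} (hM₂ : IsSymmForm M₂)
    (h₃ : ‖M₃‖ ≤ K) (h₄ : ‖M₄‖ ≤ K) (h₅ : ‖M₅‖ ≤ K)
    (hB : 1 ≤ B) (hB₁ : K * n ≤ B) (hB₂ : K * n ^ 2 ≤ B) (hB₃ : K * n ^ 3 ≤ B)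
    (hδ : 0 < δ) (hδ1 : δ ≤ 1)
    (hpos : ∀ y : Rn n, δ * ‖y‖ ^ 2 ≤ quadForm M₂ 0 y + θ * ‖y‖ ^ 2) :
    (fun s y => quadForm M₂ s y + quadForm M₃ s y + quadForm M₄ s y + quadForm M₅ s y
      + θ * ‖y‖ ^ 2
      + 64 * B ^ 4 / δ ^ 3 * (‖s‖ ^ 4 * ‖y‖ ^ 2 + 4 * ‖s‖ ^ 2 * inner ℝ s y ^ 2))
      ∈ sosForms n := by
  have hB0 : 0 < B := by positivity
  have hBB : 1 ≤ B ^ 2 := one_le_pow₀ hB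
  have hBB4 : 1 ≤ B ^ 4 := one_le_pow₀ hB
  have h1 := sosForms_quadForm_two hM₂ (c := θ - δ) fun y => by linarith [hpos y]
  have h2 := sosForms_cubic M₃ h₃ hB₁ hB₂ hB0 (α := δ / 4) (by positivity)
    (β := 4 * B ^ 2 / δ) (by field_simp; norm_num)
  have h3 := sosForms_quartic M₄ h₄ hB₁ hB₃ hB0 (α := δ / 4) (by positivity)
    (β := 16 * B ^ 4 / δ ^ 3) (by
      have : δ / 4 * (16 * B ^ 4 / δ ^ 3) = 4 * B ^ 4 / δ ^ 2 := by field_simp; norm_num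
      rw [this, le_div_iff₀ (by positivity)]
      have : δ ^ 2 ≤ 1 := pow_le_one₀ hδ.le hδ1
      nlinarith)
  have h4 := sosForms_quintic M₅ h₅ hB₂ hB₃ hB0 (α := 4 * B ^ 2 / δ) (by positivity)
    (β := 16 * B ^ 4 / δ ^ 3) (by
      have : 4 * B ^ 2 / δ * (16 * B ^ 4 / δ ^ 3) = 64 * (B ^ 2 * B ^ 4) / δ ^ 4 := by
        field_simp; norm_num
      rw [this, le_div_iff₀ (by positivity)]
      have h4 : δ ^ 4 ≤ 1 := pow_le_one₀ hδ.le hδ1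
      calc B ^ 2 * δ ^ 4 ≤ B ^ 2 * 1 := by gcongr
        _ ≤ B ^ 2 * B ^ 4 := by gcongr
        _ ≤ 64 * (B ^ 2 * B ^ 4) := by linarith [show 0 ≤ B ^ 2 * B ^ 4 by positivity])
  have h5 := sosForms_sum Finset.univ fun k _ => sosForms_smul
    (sosForms_sq ((IsLinForm.inner (n := n)).mul_coord k))
    (c := 64 * B ^ 4 / δ ^ 3 * 4) (by positivity)
  -- The compensating square δ/2 · ‖y - (8B²/δ²)‖s‖²y‖² has mixed term -8B²/δ · ‖s‖²‖y‖², which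
  -- cancels the 4B²/δ spent by each of the cubic and the quintic parts.
  have h6 := sosForms_sum Finset.univ fun k _ => sosForms_smul
    (sosForms_sq ((IsLinForm.coord (n := n) k).add
      ((IsLinForm.coord k).normSq_mul.smul (-(8 * B ^ 2 / δ ^ 2)))))
    (c := δ / 2) (by positivity)
  convert sosForms_add (sosForms_add (sosForms_add (sosForms_add (sosForms_add h1 h2) h3) h4) h5) h6
    using 3 with s y
  have e5 : ∑ k, 64 * B ^ 4 / δ ^ 3 * 4 * (inner ℝ s y * s k) ^ 2
      = 64 * B ^ 4 / δ ^ 3 * 4 * inner ℝ s y ^ 2 * ‖s‖ ^ 2 := by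
    simp only [mul_pow, ← mul_assoc, ← Finset.mul_sum, sum_coord_sq]
  have e6 : ∑ k, δ / 2 * (y k + -(8 * B ^ 2 / δ ^ 2) * (‖s‖ ^ 2 * y k)) ^ 2
      = δ / 2 * (1 + -(8 * B ^ 2 / δ ^ 2) * ‖s‖ ^ 2) ^ 2 * ‖y‖ ^ 2 := by
    simp only [← sum_coord_sq y, Finset.mul_sum]
    exact Finset.sum_congr rfl fun k _ => by ring
  rw [e5, e6]
  field_simp
  ring

theorem regHess_mem_sosForms
    {D : ∀ j : ℕ, ContinuousMultilinearMap ℝ (fun _ : Fin j => Rn n) ℝ} {p k : ℕ}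
    (hpk : (p = 3 ∧ k = 1) ∨ (p = 4 ∧ k = 2) ∨ (p = 5 ∧ k = 2)) (hD : IsSymmForm (D 2))
    (hK : ∀ j ∈ Finset.Icc 3 p, ‖D j‖ ≤ K)
    (hB : 1 ≤ B) (hB₁ : K * n ≤ B) (hB₂ : K * n ^ 2 ≤ B) (hB₃ : K * n ^ 3 ≤ B)
    (hδ : 0 < δ) (hδ1 : δ ≤ 1)
    (hpos : ∀ y : Rn n, δ * ‖y‖ ^ 2 ≤ quadForm (D 2) 0 y + θ * ‖y‖ ^ 2) :
    regHess D p k θ (64 * B ^ 4 / δ ^ (2 * k - 1)) ∈ sosForms n := by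
  have hhalf : ‖(1 / 2 : ℝ) • D 4‖ ≤ ‖D 4‖ := by
    rw [norm_smul]; norm_num; linarith [norm_nonneg (D 4)]
  have hsixth : ‖(1 / 6 : ℝ) • D 5‖ ≤ ‖D 5‖ := by
    rw [norm_smul]; norm_num; linarith [norm_nonneg (D 5)]
  rcases hpk with ⟨rfl, rfl⟩ | ⟨rfl, rfl⟩ | ⟨rfl, rfl⟩
  · convert sosForms_order_four hD (hK 3 (by simp)) hB hB₁ hB₂ hδ hpos using 1
    ext s y
    simp [regHess, formSum_hess_one]
  · have h3 := hK 3 (by simp)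
    convert sosForms_order_six hD h3 (hhalf.trans (hK 4 (by simp)))
      (M₅ := 0) (by simpa using (norm_nonneg _).trans h3) hB hB₁ hB₂ hB₃ hδ hδ1 hpos using 1
    ext s y
    simp only [regHess, quadForm_smul, quadForm_zero]
    norm_num
    exact formSum_hess_two D s y
  · convert sosForms_order_six hD (hK 3 (by simp)) (hhalf.trans (hK 4 (by simp)))
      (hsixth.trans (hK 5 (by simp))) hB hB₁ hB₂ hB₃ hδ hδ1 hpos using 1
    ext s y
    simp only [regHess, quadForm_smul]
    norm_num
    exact formSum_hess_three D s y

end ModelSos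

/-! ### The smallest Hessian eigenvalue and the shift. -/

section Eigenvalue

variable {n : ℕ}

theorem hessianMatrix_apply (f : Rn n → ℝ) (x : Rn n) (i l : Fin n) :
    hessianMatrix f x i l
      = ((iteratedFDeriv ℝ 2 f x).curryLeft (stdVec i)).curryLeft (stdVec l) (fun _ => 0) := by
  simp only [hessianMatrix, Matrix.of_apply, ContinuousMultilinearMap.curryLeft_apply]
  congr 1
  funext a
  fin_cases a <;> rfl

theorem isHermitian_hessianMatrix {f : Rn n → ℝ} {x : Rn n}
    (hf : IsSymmForm (iteratedFDeriv ℝ 2 f x)) : (hessianMatrix f x).IsHermitian := by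
  ext i l
  simp only [Matrix.conjTranspose_apply, star_trivial, hessianMatrix, Matrix.of_apply]
  rw [← hf (Equiv.swap 0 1)]
  congr 1
  funext a
  fin_cases a <;> simp

theorem quadForm_eq_dotProduct (f : Rn n → ℝ) (x s y : Rn n) :
    quadForm (iteratedFDeriv ℝ 2 f x) s y
      = (fun i => y i) ⬝ᵥ ((hessianMatrix f x).mulVec fun i => y i) := by
  rw [quadForm_expand, Subsingleton.elim (fun _ : Fin 0 => s) (fun _ => 0)]
  simp only [dotProduct, Matrix.mulVec, Finset.mul_sum, hessianMatrix_apply]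
  exact Finset.sum_congr rfl fun i _ => Finset.sum_congr rfl fun l _ => by ring

theorem hessianMinEig_mul_le_quadForm {f : Rn n → ℝ} {x : Rn n}
    (hf : IsSymmForm (iteratedFDeriv ℝ 2 f x)) (s y : Rn n) :
    hessianMinEig f x * ‖y‖ ^ 2 ≤ quadForm (iteratedFDeriv ℝ 2 f x) s y := by
  have hH := isHermitian_hessianMatrix hf
  have hfin : (spectrum ℝ (hessianMatrix f x)).Finite := by
    rw [hH.spectrum_real_eq_range_eigenvalues]
    exact Set.finite_range _
  have hpsd : (hessianMatrix f x
      - algebraMap ℝ (Matrix (Fin n) (Fin n) ℝ) (hessianMinEig f x)).PosSemidef := by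
    rw [Matrix.posSemidef_iff_isHermitian_and_spectrum_nonneg]
    constructor
    · refine hH.sub ?_
      rw [Algebra.algebraMap_eq_smul_one]
      ext i l
      simp [Matrix.one_apply, eq_comm]
    · rw [← spectrum.sub_singleton_eq]
      rintro _ ⟨μ, hμ, _, rfl, rfl⟩
      exact sub_nonneg.2 (csInf_le hfin.bddBelow hμ)
  have h := hpsd.dotProduct_mulVec_nonneg fun i => y i
  rw [Matrix.sub_mulVec, dotProduct_sub, Algebra.algebraMap_eq_smul_one, Matrix.smul_mulVec,
    Matrix.one_mulVec, dotProduct_smul] at h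
  rw [quadForm_eq_dotProduct, ← sum_coord_sq]
  have e : (star fun i => y i) ⬝ᵥ (fun i => y i) = ∑ i, y i ^ 2 := by
    simp [dotProduct, sq]
  rw [e] at h
  simpa using h

theorem neg_norm_le_hessianMinEig {f : Rn n → ℝ} {x : Rn n}
    (hf : IsSymmForm (iteratedFDeriv ℝ 2 f x)) :
    -‖iteratedFDeriv ℝ 2 f x‖ ≤ hessianMinEig f x := by
  have hH := isHermitian_hessianMatrix hf
  unfold hessianMinEig
  rw [hH.spectrum_real_eq_range_eigenvalues]
  -- The second argument covers n = 0, where the spectrum is empty and its infimum is 0 by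
  -- convention.
  refine Real.le_sInf ?_ (by simp)
  rintro _ ⟨i, rfl⟩
  have h1 := quadForm_eq_dotProduct f x 0 (hH.eigenvectorBasis i)
  have h3 := hH.eigenvectorBasis.orthonormal.1 i
  have h4 : (fun j => hH.eigenvectorBasis i j) ⬝ᵥ (fun j => hH.eigenvectorBasis i j) = 1 := by
    have := sum_coord_sq (hH.eigenvectorBasis i)
    rw [h3] at this
    simpa [dotProduct, sq] using this
  have h2 := hH.mulVec_eigenvectorBasis i
  have h5 : quadForm (iteratedFDeriv ℝ 2 f x) 0 (hH.eigenvectorBasis i) = hH.eigenvalues i := by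
    rw [h1]
    erw [h2]
    rw [dotProduct_smul]
    erw [h4]
    simp
  rw [← h5, quadForm]
  refine neg_le_of_abs_le ?_
  rw [← Real.norm_eq_abs]
  refine (ContinuousMultilinearMap.le_opNorm _ _).trans ?_
  have := norm_curryLeft_le ((iteratedFDeriv ℝ 2 f x).curryLeft (hH.eigenvectorBasis i))
    (hH.eigenvectorBasis i)
  have h6 := norm_curryLeft_le (iteratedFDeriv ℝ 2 f x) (hH.eigenvectorBasis i)
  simp only [h3, mul_one] at this h6
  simpa using this.trans h6

theorem le_add_hessianShift (δ l : ℝ) : δ ≤ l + hessianShift δ l := by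
  unfold hessianShift
  split_ifs <;> linarith

theorem hessianShift_nonneg (δ l : ℝ) : 0 ≤ hessianShift δ l := by
  unfold hessianShift
  split_ifs <;> linarith

end Eigenvalue

/-! ### Decrease of the Taylor polynomial at a model minimizer. -/

section Decrease

variable {n : ℕ}

theorem quadForm_smul_self {j : ℕ}
    (M : ContinuousMultilinearMap ℝ (fun _ : Fin (j + 2) => Rn n) ℝ) (s : Rn n) (t : ℝ) :
    quadForm M (t • s) s = t ^ j * M (fun _ => s) := by
  rw [quadForm, apply_const_eq M, apply_const_eq (M.curryLeft s),
    ContinuousMultilinearMap.map_smul_univ _ (fun _ => t) (fun _ => s)]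
  simp

theorem regGrad_eq_zero {D : ∀ j : ℕ, ContinuousMultilinearMap ℝ (fun _ : Fin j => Rn n) ℝ}
    {p k : ℕ} {θ σ : ℝ} (hp : 1 ≤ p) (hD : ∀ j ≤ p, IsSymmForm (D j)) {s : Rn n}
    (hs : ∀ t, regModel D p k θ σ s ≤ regModel D p k θ σ t) (y : Rn n) :
    regGrad D p k θ σ s y = 0 := by
  have h := hasDerivAt_regModel hp hD k θ σ s y 0
  have hmin : IsLocalMin (fun t : ℝ => regModel D p k θ σ (s + t • y)) 0 :=
    Filter.Eventually.of_forall fun t => by simpa using hs (s + t • y)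
  simpa using hmin.hasDerivAt_eq_zero h

theorem regHess_line (D : ∀ j : ℕ, ContinuousMultilinearMap ℝ (fun _ : Fin j => Rn n) ℝ)
    (p : ℕ) {k : ℕ} (hk : 1 ≤ k) (θ σ t : ℝ) (s : Rn n) :
    regHess D p k θ σ (t • s) s = formSum (shiftForm (shiftForm D s) s) (p - 2) (t • s)
      + θ * ‖s‖ ^ 2 + (2 * k + 1) * (σ * ‖s‖ ^ (2 * k + 2)) * t ^ (2 * k) := by
  obtain ⟨k, rfl⟩ := Nat.exists_eq_add_of_le' hk
  have hn : ‖t • s‖ ^ 2 = t ^ 2 * ‖s‖ ^ 2 := by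
    rw [norm_smul, mul_pow, Real.norm_eq_abs, sq_abs]
  simp only [regHess, Nat.add_sub_cancel, pow_mul, hn, real_inner_smul_left,
    real_inner_self_eq_norm_sq]
  push_cast
  ring

theorem regGrad_self (D : ∀ j : ℕ, ContinuousMultilinearMap ℝ (fun _ : Fin j => Rn n) ℝ)
    (p k : ℕ) (θ σ : ℝ) (s : Rn n) :
    regGrad D p k θ σ s s = formSum (shiftForm D s) (p - 1) s
      + θ * ‖s‖ ^ 2 + σ * ‖s‖ ^ (2 * k + 2) := by
  simp only [regGrad, real_inner_self_eq_norm_sq]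
  ring

/-- Decrease of the Taylor polynomial at a minimizer of a convex regularized model. The proof
applies a quadrature rule with positive weights to the second derivative along the step. -/
theorem formSum_decrease {D : ∀ j : ℕ, ContinuousMultilinearMap ℝ (fun _ : Fin j => Rn n) ℝ}
    {p k : ℕ} {θ τ σ δ : ℝ} (hpk : (p = 3 ∧ k = 1) ∨ (p = 4 ∧ k = 2) ∨ (p = 5 ∧ k = 2))
    (hD : ∀ j ≤ p, IsSymmForm (D j)) (hτ : ∀ s y, 0 ≤ regHess D p k θ τ s y) (hτσ : τ ≤ σ)
    {s : Rn n} (hs : ∀ t, regModel D p k θ σ s ≤ regModel D p k θ σ t)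
    (hδ : δ * ‖s‖ ^ 2 ≤ quadForm (D 2) 0 s + θ * ‖s‖ ^ 2) :
    δ / 96 * ‖s‖ ^ 2 + θ / 2 * ‖s‖ ^ 2 + σ / (2 * k + 2) * ‖s‖ ^ (2 * k + 2)
      ≤ D 0 (fun _ => 0) - formSum D p s := by
  -- Raising the parameter from τ to σ only adds a nonnegative term to the Hessian form.
  have hσ : ∀ t : ℝ, 0 ≤ regHess D p k θ σ (t • s) s := fun t => by
    have h1 : regHess D p k θ σ (t • s) s - regHess D p k θ τ (t • s) s = (σ - τ) *
        (‖t • s‖ ^ (2 * k) * ‖s‖ ^ 2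
          + 2 * k * ‖t • s‖ ^ (2 * (k - 1)) * inner ℝ (t • s) s ^ 2) := by
      simp only [regHess]
      ring
    have h2 : 0 ≤ regHess D p k θ σ (t • s) s - regHess D p k θ τ (t • s) s := by
      rw [h1]
      have := sub_nonneg.2 hτσ
      positivity
    linarith [hτ (t • s) s]
  have hg := regGrad_eq_zero (by omega) hD hs s
  have h0 := quadForm_smul_self (D 2) s 0
  have hd0 : D 0 (fun _ => s) = D 0 (fun _ => 0) := by
    congr 1
    funext i
    exact i.elim0
  have hshift : ∀ j, shiftForm D s j (fun _ => s) = D (j + 1) (fun _ => s) :=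
    fun j => (apply_const_eq _ _).symm
  simp only [zero_smul, pow_zero, one_mul] at h0
  rw [h0] at hδ
  -- For the weight t on [0,1], the nodes 0, 2/5, 4/5, 1 with weights 1/96, 25/144, 25/96, 1/18
  -- integrate polynomials of degree at most 4 exactly. `linarith` finds this combination.
  have q0 := hσ 0
  have q1 := hσ (2 / 5)
  have q2 := hσ (4 / 5)
  have q3 := hσ 1
  rw [regHess_line D p (by omega)] at q0 q1 q2 q3
  rw [regGrad_self] at hg
  rcases hpk with ⟨rfl, rfl⟩ | ⟨rfl, rfl⟩ | ⟨rfl, rfl⟩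
  · simp only [formSum_hess_one, quadForm_smul_self, Nat.reduceSub] at q0 q1 q2 q3
    simp only [formSum, Finset.sum_range_succ, Finset.sum_range_zero, hshift, hd0,
      Nat.factorial] at hg ⊢
    norm_num at q0 q1 q2 q3 hg ⊢
    linarith
  · simp only [formSum_hess_two, quadForm_smul_self, Nat.reduceSub] at q0 q1 q2 q3
    simp only [formSum, Finset.sum_range_succ, Finset.sum_range_zero, hshift, hd0,
      Nat.factorial] at hg ⊢
    norm_num at q0 q1 q2 q3 hg ⊢
    linarith
  · simp only [formSum_hess_three, quadForm_smul_self, Nat.reduceSub] at q0 q1 q2 q3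
    simp only [formSum, Finset.sum_range_succ, Finset.sum_range_zero, hshift, hd0,
      Nat.factorial] at hg ⊢
    norm_num at q0 q1 q2 q3 hg ⊢
    linarith

end Decrease

/-! ### Taylor remainders and the gradient after the step. -/

section Taylor

variable {n : ℕ}

/-- The remainder vanishes at 0 and its derivative is the remainder of one order lower, so the bound
K survives each integration over [0,1]. The factorial gain is not needed. -/
theorem abs_taylor_remainder_le {m : ℕ} {g : ℕ → ℝ → ℝ} {K : ℝ}
    (hg : ∀ j < m, ∀ t, HasDerivAt (g j) (g (j + 1) t) t)
    (hK : ∀ t ∈ Set.Icc (0 : ℝ) 1, |g m t - g m 0| ≤ K) :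
    ∀ t ∈ Set.Icc (0 : ℝ) 1,
      |g 0 t - ∑ j ∈ Finset.range (m + 1), (1 / (Nat.factorial j : ℝ)) * g j 0 * t ^ j| ≤ K := by
  induction m generalizing g with
  | zero => simpa using hK
  | succ m ih =>
    have ih := ih (g := fun j => g (j + 1)) (fun j hj => hg (j + 1) (by omega)) hK
    have hd : ∀ t, HasDerivAt (fun t => g 0 t
        - ∑ j ∈ Finset.range (m + 2), (1 / (Nat.factorial j : ℝ)) * g j 0 * t ^ j)
        (g 1 t - ∑ j ∈ Finset.range (m + 1), (1 / (Nat.factorial j : ℝ)) * g (j + 1) 0 * t ^ j)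
        t := by
      intro t
      refine (hg 0 (by omega) t).sub ?_
      have h1 : ∀ j ∈ Finset.range (m + 1), HasDerivAt
          (fun t => (1 / (Nat.factorial (j + 1) : ℝ)) * g (j + 1) 0 * t ^ (j + 1))
          ((1 / (Nat.factorial j : ℝ)) * g (j + 1) 0 * t ^ j) t := by
        intro j _
        refine ((hasDerivAt_pow (j + 1) t).const_mul
          ((1 / (Nat.factorial (j + 1) : ℝ)) * g (j + 1) 0)).congr_deriv ?_
        rw [Nat.factorial_succ]
        push_cast
        field_simp
      have h2 := (HasDerivAt.fun_sum h1).fun_add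
        (hasDerivAt_const t ((1 / (Nat.factorial 0 : ℝ)) * g 0 0 * 1))
      simp only [Finset.sum_range_succ' _ (m + 1), pow_zero]
      simpa using h2
    intro t ht
    have h := norm_image_sub_le_of_norm_deriv_le_segment' (a := 0) (b := 1)
      (fun z _ => (hd z).hasDerivWithinAt) (fun z hz => ih z ⟨hz.1, hz.2.le⟩) t ht
    have hz : g 0 0 - ∑ j ∈ Finset.range (m + 2), (1 / (Nat.factorial j : ℝ)) * g j 0 * 0 ^ j
        = 0 := by
      rw [Finset.sum_range_succ']
      simp
    rw [hz, sub_zero, sub_zero, Real.norm_eq_abs] at h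
    have hK0 : 0 ≤ K := (abs_nonneg _).trans (hK 0 (by simp))
    exact h.trans (mul_le_of_le_one_right hK0 ht.2)

theorem hasDerivAt_iteratedFDeriv_line {f : Rn n → ℝ} {p j : ℕ} (hf : ContDiff ℝ p f) (hj : j < p)
    (x s : Rn n) (v : Fin j → Rn n) (t : ℝ) :
    HasDerivAt (fun t : ℝ => iteratedFDeriv ℝ j f (x + t • s) v)
      ((iteratedFDeriv ℝ (j + 1) f (x + t • s)).curryLeft s v) t := by
  have h1 : HasDerivAt (fun t : ℝ => x + t • s) s t := by
    simpa using ((hasDerivAt_id t).smul_const s).const_add x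
  have hd : DifferentiableAt ℝ (iteratedFDeriv ℝ j f) (x + t • s) :=
    hf.differentiable_iteratedFDeriv (by exact_mod_cast hj) _
  have h2 := ((ContinuousMultilinearMap.apply ℝ (fun _ : Fin j => Rn n) ℝ v).hasFDerivAt.comp _
    hd.hasFDerivAt).comp_hasDerivAt t h1
  rw [iteratedFDeriv_curryLeft]
  exact h2

theorem IsSmoothLip.norm_sub_line_le {f : Rn n → ℝ} {p : ℕ} {L : ℝ} (hf : IsSmoothLip f p L)
    (x s : Rn n) {t : ℝ} (ht : t ∈ Set.Icc (0 : ℝ) 1) :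
    ‖iteratedFDeriv ℝ p f (x + t • s) - iteratedFDeriv ℝ p f x‖
      ≤ (Nat.factorial (p - 1) : ℝ) * L * ‖s‖ := by
  -- The sign of L is not assumed here; nonnegativity of L‖s‖ is read off the Lipschitz bound
  -- itself.
  have h1 := hf.lipschitz (x + (1 : ℝ) • s) x
  have hK : 0 ≤ (Nat.factorial (p - 1) : ℝ) * L * ‖s‖ := by
    simpa using (norm_nonneg _).trans h1
  refine (hf.lipschitz _ _).trans ?_
  rw [add_sub_cancel_left, norm_smul, Real.norm_of_nonneg ht.1, mul_left_comm]
  exact mul_le_of_le_one_left hK ht.2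

theorem IsSmoothLip.abs_sub_taylorModel_le {f : Rn n → ℝ} {p : ℕ} {L : ℝ}
    (hf : IsSmoothLip f p L) (x s : Rn n) :
    |f (x + s) - taylorModel f p x s| ≤ (Nat.factorial (p - 1) : ℝ) * L * ‖s‖ ^ (p + 1) := by
  have h := abs_taylor_remainder_le (m := p)
    (g := fun j t => iteratedFDeriv ℝ j f (x + t • s) (fun _ => s))
    (K := (Nat.factorial (p - 1) : ℝ) * L * ‖s‖ ^ (p + 1))
    (fun j hj t => by
      rw [apply_const_eq]
      exact hasDerivAt_iteratedFDeriv_line hf.contDiff hj x s _ t)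
    (fun t ht => by
      rw [zero_smul, add_zero, ← sub_apply, ← Real.norm_eq_abs]
      refine (ContinuousMultilinearMap.le_opNorm _ _).trans ?_
      rw [Finset.prod_const, Finset.card_univ, Fintype.card_fin, pow_succ', ← mul_assoc]
      gcongr
      exact hf.norm_sub_line_le x s ht) 1 (by simp)
  simpa [taylorModel] using h

theorem IsSmoothLip.abs_fderiv_sub_le {f : Rn n → ℝ} {p : ℕ} {L : ℝ}
    (hf : IsSmoothLip f (p + 1) L) (x s y : Rn n) :
    |fderiv ℝ f (x + s) y - formSum (shiftForm (fun j => iteratedFDeriv ℝ j f x) y) p s|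
      ≤ (Nat.factorial p : ℝ) * L * ‖s‖ ^ (p + 1) * ‖y‖ := by
  have h := abs_taylor_remainder_le (m := p)
    (g := fun j t => (iteratedFDeriv ℝ (j + 1) f (x + t • s)).curryLeft y (fun _ => s))
    (K := (Nat.factorial p : ℝ) * L * ‖s‖ ^ (p + 1) * ‖y‖)
    (fun j hj t => by
      have h1 := hasDerivAt_iteratedFDeriv_line hf.contDiff (show j + 1 < p + 1 by omega) x s
        (Fin.cons y (fun _ => s) : Fin (j + 1) → Rn n) t
      have hsymm : IsSymmForm (iteratedFDeriv ℝ (j + 2) f (x + t • s)) :=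
        (hf.contDiff.of_le (by norm_cast; omega)).isSymmForm_iteratedFDeriv _
      -- Differentiation inserts s in the first slot and pushes y to the second; symmetry moves y
      -- back to the front.
      rw [← hsymm.apply_update s y 1]
      refine h1.congr_deriv ?_
      rw [ContinuousMultilinearMap.curryLeft_apply]
      congr 1
      funext i
      refine Fin.cases (by simp) (fun i => ?_) i
      refine Fin.cases (by simp) (fun i => ?_) i
      simp [Fin.ext_iff])
    (fun t ht => by
      rw [zero_smul, add_zero, ContinuousMultilinearMap.curryLeft_apply,
        ContinuousMultilinearMap.curryLeft_apply,
        ← sub_apply, ← Real.norm_eq_abs]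
      refine (ContinuousMultilinearMap.le_opNorm _ _).trans ?_
      rw [Fin.prod_univ_succ]
      simp only [Fin.cons_zero, Fin.cons_succ, Finset.prod_const, Finset.card_univ,
        Fintype.card_fin]
      calc _ ≤ (Nat.factorial p : ℝ) * L * ‖s‖ * (‖y‖ * ‖s‖ ^ p) := by
            gcongr
            exact hf.norm_sub_line_le x s ht
        _ = _ := by ring) 1 (by simp)
  have e : (iteratedFDeriv ℝ 1 f (x + s)).curryLeft y (fun _ => s) = fderiv ℝ f (x + s) y := by
    rw [ContinuousMultilinearMap.curryLeft_apply, iteratedFDeriv_one_apply]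
    simp
  simpa [formSum, shiftForm, e] using h

/-- The stationarity condition of the model is tested in the direction of the new gradient G, and
the resulting bound on ‖G‖² is divided by ‖G‖. -/
theorem IsSmoothLip.norm_gradient_le {f : Rn n → ℝ} {p k : ℕ} {L θ σ : ℝ} (hp : 1 ≤ p)
    (hf : IsSmoothLip f p L) (hθ : 0 ≤ θ) (hσ : 0 ≤ σ) {x s : Rn n}
    (hs : ∀ t, regModel (fun j => iteratedFDeriv ℝ j f x) p k θ σ s
      ≤ regModel (fun j => iteratedFDeriv ℝ j f x) p k θ σ t) :
    ‖gradient f (x + s)‖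
      ≤ (Nat.factorial (p - 1) : ℝ) * L * ‖s‖ ^ p + θ * ‖s‖ + σ * ‖s‖ ^ (2 * k + 1) := by
  obtain ⟨p, rfl⟩ := Nat.exists_eq_add_of_le' hp
  set G := gradient f (x + s) with hG
  have h1 := hf.abs_fderiv_sub_le x s G
  have h2 := regGrad_eq_zero hp
    (fun j hj => (hf.contDiff.of_le (by exact_mod_cast hj)).isSymmForm_iteratedFDeriv x) hs G
  have h3 : fderiv ℝ f (x + s) G = ‖G‖ ^ 2 := by
    rw [← real_inner_self_eq_norm_sq]
    nth_rewrite 2 [hG]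
    rw [gradient, InnerProductSpace.toDual_symm_apply]
  have h4 := (abs_le.1 (abs_real_inner_le_norm s G)).1
  have h5 := mul_le_mul_of_nonneg_left h4 hθ
  have h6 := mul_le_mul_of_nonneg_left h4 (show 0 ≤ σ * ‖s‖ ^ (2 * k) by positivity)
  have h7 := (abs_le.1 h1).2
  rw [h3] at h7
  simp only [regGrad, Nat.add_sub_cancel] at h2 ⊢
  rcases (norm_nonneg G).eq_or_lt with h0 | h0
  · rw [← h0]
    have := (norm_nonneg _).trans (hf.lipschitz (x + s) x)
    simp only [Nat.add_sub_cancel, add_sub_cancel_left] at this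
    have h8 : 0 ≤ (Nat.factorial p : ℝ) * L * ‖s‖ ^ (p + 1) := by
      rw [pow_succ', ← mul_assoc]
      positivity
    positivity
  · refine le_of_mul_le_mul_right ?_ h0
    calc ‖G‖ * ‖G‖ = ‖G‖ ^ 2 := by ring
      _ ≤ (Nat.factorial p : ℝ) * L * ‖s‖ ^ (p + 1) * ‖G‖ + θ * (‖s‖ * ‖G‖)
          + σ * ‖s‖ ^ (2 * k) * (‖s‖ * ‖G‖) := by linarith
      _ = _ := by ring

end Taylor

/-! ### Scalar inequalities for σ and the step length. -/

section RealLemmas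

theorem le_div_pow_of_le {c δ : ℝ} (hc : 0 ≤ c) (hδ : 0 < δ) (hδ1 : δ ≤ 1) (m : ℕ) :
    c ≤ c / δ ^ m := by
  rw [le_div_iff₀ (by positivity)]
  exact mul_le_of_le_one_right hc (pow_le_one₀ hδ.le hδ1)

/-- For odd p both sides have the power u^(p+1) = u^(2k+2), which cancels. For p = 4 the powers
differ: the σ term gives σu ≤ Q, the δ term gives δ ≤ 16Qu³ (16 = 96/6), and u is eliminated between
them. -/
theorem regularization_le_of_growth {p k : ℕ}
    (hpk : (p = 3 ∧ k = 1) ∨ (p = 4 ∧ k = 2) ∨ (p = 5 ∧ k = 2))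
    {Q δ σ u : ℝ} (hδ : 0 < δ) (hδ1 : δ ≤ 1) (hσ : 0 ≤ σ) (hu : 0 < u) (hQ : 0 ≤ Q)
    (h : δ / 96 * u ^ 2 + σ / (2 * k + 2) * u ^ (2 * k + 2) ≤ Q / 6 * u ^ (p + 1)) :
    σ ≤ (1 + Q + 16 * Q ^ 4) / δ ^ (2 * k - 1) := by
  have hC : 0 ≤ 1 + Q + 16 * Q ^ 4 := by positivity
  have hC' : Q ≤ 1 + Q + 16 * Q ^ 4 := by linarith [show 0 ≤ 16 * Q ^ 4 by positivity]
  have hδu : 0 < δ / 96 * u ^ 2 := by positivity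
  refine le_trans ?_ (show (1 + Q + 16 * Q ^ 4) / δ ≤ _ from ?_)
  · rw [le_div_iff₀ hδ]
    have hodd : ∀ m : ℕ, σ / 6 * u ^ m ≤ Q / 6 * u ^ m → σ * δ ≤ 1 + Q + 16 * Q ^ 4 := by
      intro m hm
      have h1 := le_of_mul_le_mul_right hm (by positivity)
      have h2 : σ * δ ≤ σ := mul_le_of_le_one_right hσ hδ1
      linarith
    rcases hpk with ⟨rfl, rfl⟩ | ⟨rfl, rfl⟩ | ⟨rfl, rfl⟩
    · refine hodd 4 ?_
      norm_num at h
      have : 0 ≤ σ * u ^ 4 := by positivity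
      linarith
    · norm_num at h
      have h1 : σ * u ≤ Q := by
        have h2 : (σ * u) * u ^ 5 ≤ Q * u ^ 5 := by
          calc σ * u * u ^ 5 = σ * u ^ 6 := by ring
            _ ≤ _ := by linarith
        exact le_of_mul_le_mul_right h2 (by positivity)
      have h2 : δ ≤ 16 * Q * u ^ 3 := by
        have h3 : δ * u ^ 2 ≤ 16 * Q * u ^ 3 * u ^ 2 := by
          calc δ * u ^ 2 ≤ 16 * (Q * u ^ 5) := by
                linarith [show 0 ≤ σ / 6 * u ^ 6 by positivity]
            _ = _ := by ring
        exact le_of_mul_le_mul_right h3 (by positivity)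
      -- If σ ≥ 1, replacing σ by σ³ makes the bound depend only on the product σu.
      rcases le_total σ 1 with h3 | h3
      · have : σ * δ ≤ 1 * 1 := by gcongr
        linarith [show 0 ≤ 16 * Q ^ 4 by positivity]
      · have h4 : σ ≤ σ ^ 3 := le_self_pow₀ h3 (by norm_num)
        calc σ * δ ≤ σ ^ 3 * (16 * Q * u ^ 3) := by gcongr
          _ = 16 * Q * (σ * u) ^ 3 := by ring
          _ ≤ 16 * Q * Q ^ 3 := by gcongr
          _ ≤ _ := by linarith
    · refine hodd 6 ?_
      norm_num at h
      linarith
  · gcongr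
    exact pow_le_of_le_one hδ.le hδ1 (by omega)

/-- If u < cε^β, the conditions on β make both terms at most a multiple of cε, with total at most (K
+ C)cε. The choice of c puts this below ε/2. -/
theorem step_lower_bound {p k : ℕ} (hp : 1 ≤ p) {K C ε a β σ u : ℝ} (hK : 0 ≤ K) (hC : 0 ≤ C)
    (hε : 0 < ε) (hε1 : ε < 1)
    (hβp : 1 ≤ β * p) (hβk : 1 + a * ((2 * k - 1 : ℕ) : ℝ) ≤ β * ((2 * k + 1 : ℕ) : ℝ))
    (hσ : σ ≤ C / (ε ^ a) ^ (2 * k - 1)) (hu : 0 ≤ u)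
    (h : ε / 2 ≤ K * u ^ p + σ * u ^ (2 * k + 1)) :
    1 / (2 * (K + C) + 1) * ε ^ β ≤ u := by
  set c := 1 / (2 * (K + C) + 1) with hc
  have hc0 : 0 < c := by positivity
  have hc1 : c ≤ 1 := by
    rw [hc, div_le_one (by positivity)]
    linarith
  by_contra! hlt
  have hpow : ∀ m : ℕ, 1 ≤ m → u ^ m ≤ c * ε ^ (β * m) := by
    intro m hm
    calc u ^ m ≤ (c * ε ^ β) ^ m := by gcongr
      _ = c ^ m * ε ^ (β * m) := by rw [mul_pow, ← Real.rpow_mul_natCast hε.le]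
      _ ≤ c * ε ^ (β * m) := by
        gcongr
        exact pow_le_of_le_one hc0.le hc1 (by omega)
  have h1 : K * u ^ p ≤ K * (c * ε) := by
    gcongr
    refine (hpow p hp).trans ?_
    gcongr
    simpa using Real.rpow_le_rpow_of_exponent_ge hε hε1.le hβp
  have h2 : σ * u ^ (2 * k + 1) ≤ C * (c * ε) := by
    calc σ * u ^ (2 * k + 1)
        ≤ C / (ε ^ a) ^ (2 * k - 1) * (c * ε ^ (β * ((2 * k + 1 : ℕ) : ℝ))) := by
          gcongr
          exact hpow _ (by omega)
      _ = C * (c * ε ^ (β * ((2 * k + 1 : ℕ) : ℝ) - a * ((2 * k - 1 : ℕ) : ℝ))) := by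
          rw [← Real.rpow_mul_natCast hε.le, Real.rpow_sub hε]
          ring
      _ ≤ C * (c * ε ^ (1 : ℝ)) := by
          gcongr C * (c * ?_)
          exact Real.rpow_le_rpow_of_exponent_ge hε hε1.le (by linarith)
      _ = _ := by rw [Real.rpow_one]
  have h3 : (K + C) * c < 1 / 2 := by
    rw [hc, mul_one_div, div_lt_iff₀ (by positivity)]
    linarith
  have h4 : (K + C) * c * ε < 1 / 2 * ε := by gcongr
  linarith

end RealLemmas

/-! ### Bounds along a run of the algorithm. -/

section Algorithm

variable {n : ℕ}

theorem regOrder_eq {p k : ℕ} (hpk : (p = 3 ∧ k = 1) ∨ (p = 4 ∧ k = 2) ∨ (p = 5 ∧ k = 2)) :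
    regOrder p = 2 * k + 2 := by
  rcases hpk with ⟨rfl, rfl⟩ | ⟨rfl, rfl⟩ | ⟨rfl, rfl⟩ <;> simp [regOrder, show ¬ Odd 4 by decide,
    show Odd 3 by decide, show Odd 5 by decide]

theorem sosTaylorModel_eq {p k : ℕ}
    (hpk : (p = 3 ∧ k = 1) ∨ (p = 4 ∧ k = 2) ∨ (p = 5 ∧ k = 2))
    (f : Rn n → ℝ) (δ σ : ℝ) (x : Rn n) :
    sosTaylorModel f p δ x σ = regModel (fun j => iteratedFDeriv ℝ j f x) p k
      (hessianShift δ (hessianMinEig f x)) σ := by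
  ext s
  simp only [sosTaylorModel, regModel, taylorModel, formSum, regOrder_eq hpk]
  push_cast
  rfl

theorem IsSmoothLip.isSymmForm {f : Rn n → ℝ} {p : ℕ} {L : ℝ} (hf : IsSmoothLip f p L)
    (x : Rn n) : ∀ j ≤ p, IsSymmForm (iteratedFDeriv ℝ j f x) := fun _ hj =>
  (hf.contDiff.of_le (by exact_mod_cast hj)).isSymmForm_iteratedFDeriv x

theorem le_quadForm_add_shift {f : Rn n → ℝ} {x : Rn n}
    (hf : IsSymmForm (iteratedFDeriv ℝ 2 f x)) (δ : ℝ) (y : Rn n) :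
    δ * ‖y‖ ^ 2 ≤ quadForm (iteratedFDeriv ℝ 2 f x) 0 y
      + hessianShift δ (hessianMinEig f x) * ‖y‖ ^ 2 := by
  have h1 := hessianMinEig_mul_le_quadForm hf 0 y
  have h2 := mul_le_mul_of_nonneg_right (le_add_hessianShift δ (hessianMinEig f x))
    (sq_nonneg ‖y‖)
  linarith

theorem isSosConvex_sosTaylorModel {p k : ℕ}
    (hpk : (p = 3 ∧ k = 1) ∨ (p = 4 ∧ k = 2) ∨ (p = 5 ∧ k = 2))
    {f : Rn n → ℝ} {L K B δ : ℝ} (hf : IsSmoothLip f p L) {x : Rn n}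
    (hK : ∀ j ∈ Finset.Icc 3 p, ‖iteratedFDeriv ℝ j f x‖ ≤ K)
    (hB : 1 ≤ B) (hB₁ : K * n ≤ B) (hB₂ : K * n ^ 2 ≤ B) (hB₃ : K * n ^ 3 ≤ B)
    (hδ : 0 < δ) (hδ1 : δ ≤ 1) :
    IsSosConvex (sosTaylorModel f p δ x (64 * B ^ 4 / δ ^ (2 * k - 1))) := by
  rw [sosTaylorModel_eq hpk]
  have hsymm := hf.isSymmForm x
  obtain ⟨q, hq⟩ := exists_poly_regModel (fun j => iteratedFDeriv ℝ j f x) p k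
    (hessianShift δ (hessianMinEig f x)) (64 * B ^ 4 / δ ^ (2 * k - 1))
  exact isSosConvex_of_mem_sosForms q hq (hasDerivAt_regModel (by omega) hsymm _ _ _)
    (hasDerivAt_regGrad (by omega) hsymm _ _ _)
    (regHess_mem_sosForms hpk (hsymm 2 (by omega)) hK hB hB₁ hB₂ hB₃ hδ hδ1
      (le_quadForm_add_shift (hsymm 2 (by omega)) δ))

theorem taylorModel_decrease {p k : ℕ}
    (hpk : (p = 3 ∧ k = 1) ∨ (p = 4 ∧ k = 2) ∨ (p = 5 ∧ k = 2))
    {f : Rn n → ℝ} {L δ τ σ : ℝ} (hf : IsSmoothLip f p L) {x s : Rn n}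
    (hτ : IsSosConvex (sosTaylorModel f p δ x τ)) (hτσ : τ ≤ σ)
    (hs : ∀ t, sosTaylorModel f p δ x σ s ≤ sosTaylorModel f p δ x σ t) :
    δ / 96 * ‖s‖ ^ 2 + hessianShift δ (hessianMinEig f x) / 2 * ‖s‖ ^ 2
        + σ / (2 * k + 2) * ‖s‖ ^ (2 * k + 2) ≤ f x - taylorModel f p x s := by
  have hsymm := hf.isSymmForm x
  simp only [sosTaylorModel_eq hpk] at hτ hs
  have h := formSum_decrease hpk hsymm
    (fun s y => hτ.hess_nonneg (hasDerivAt_regModel (by omega) hsymm _ _ _)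
      (hasDerivAt_regGrad (by omega) hsymm _ _ _) s y)
    hτσ hs (le_quadForm_add_shift (hsymm 2 (by omega)) δ s)
  simpa [taylorModel, formSum] using h

theorem norm_gradient_step_le {p k : ℕ}
    (hpk : (p = 3 ∧ k = 1) ∨ (p = 4 ∧ k = 2) ∨ (p = 5 ∧ k = 2))
    {f : Rn n → ℝ} {L δ σ : ℝ} (hf : IsSmoothLip f p L) (hσ : 0 ≤ σ) {x s : Rn n}
    (hs : ∀ t, sosTaylorModel f p δ x σ s ≤ sosTaylorModel f p δ x σ t) :
    ‖gradient f (x + s)‖ ≤ (Nat.factorial (p - 1) : ℝ) * L * ‖s‖ ^ p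
      + hessianShift δ (hessianMinEig f x) * ‖s‖ + σ * ‖s‖ ^ (2 * k + 1) := by
  simp only [sosTaylorModel_eq hpk] at hs
  exact hf.norm_gradient_le (by omega) (hessianShift_nonneg _ _) hσ hs

/-- Iterations with a large regularization parameter are successful. -/
theorem regularization_le_of_unsuccessful {p k : ℕ}
    (hpk : (p = 3 ∧ k = 1) ∨ (p = 4 ∧ k = 2) ∨ (p = 5 ∧ k = 2))
    {f : Rn n → ℝ} {L δ τ σ η : ℝ} (hL : 0 ≤ L) (hf : IsSmoothLip f p L) {x s : Rn n}
    (hη1 : η < 1) (hδ : 0 < δ) (hδ1 : δ ≤ 1) (hσ : 0 ≤ σ)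
    (hτ : IsSosConvex (sosTaylorModel f p δ x τ)) (hτσ : τ ≤ σ)
    (hs : ∀ t, sosTaylorModel f p δ x σ s ≤ sosTaylorModel f p δ x σ t)
    (hgrad : 0 < ‖gradient f x‖) (hρ : ¬ η < decreaseRatio f p x s) {Q : ℝ}
    (hQ : Q = 6 * ((Nat.factorial (p - 1) : ℝ) * L) / (1 - η)) :
    σ ≤ (1 + Q + 16 * Q ^ 4) / δ ^ (2 * k - 1) := by
  have hη : 0 < 1 - η := by linarith
  -- With a zero step the gradient estimate would force the gradient at x to vanish.
  have hu : 0 < ‖s‖ := by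
    rw [norm_pos_iff]
    rintro rfl
    have h := norm_gradient_step_le hpk hf hσ hs
    rw [add_zero, norm_zero, zero_pow (by omega), zero_pow (by omega)] at h
    simp only [mul_zero, add_zero] at h
    linarith
  have hdec := taylorModel_decrease hpk hf hτ hτσ hs
  have hshift := hessianShift_nonneg δ (hessianMinEig f x)
  have h1 : δ / 96 * ‖s‖ ^ 2 + σ / (2 * k + 2) * ‖s‖ ^ (2 * k + 2)
      ≤ f x - taylorModel f p x s := by
    have : 0 ≤ hessianShift δ (hessianMinEig f x) / 2 * ‖s‖ ^ 2 := by positivity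
    linarith
  have h2 : 0 < f x - taylorModel f p x s := lt_of_lt_of_le (by positivity) h1
  rw [decreaseRatio, not_lt, div_le_iff₀ h2] at hρ
  have h3 := (abs_le.1 (hf.abs_sub_taylorModel_le x s)).2
  refine regularization_le_of_growth hpk hδ hδ1 hσ hu (by rw [hQ]; positivity) (h1.trans ?_)
  -- Failure of the ratio test means that (1 - η) times the predicted decrease is at most the Taylor
  -- error (p-1)!L‖s‖^(p+1).
  have h4 : Q / 6 = (Nat.factorial (p - 1) : ℝ) * L / (1 - η) := by
    rw [hQ]; ring
  rw [h4, div_mul_eq_mul_div, le_div_iff₀ hη]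
  linarith

section Run

variable {p k : ℕ} {f : Rn n → ℝ} {L K B ε a η γ₁ γ₂ σmin : ℝ} {N : ℕ} {x s : ℕ → Rn n}
  {σbar σ σr : ℕ → ℝ}

theorem IsARpSosRun.σmin_le (hrun : IsARpSosRun f p ε a η γ₁ γ₂ σmin N x s σbar σ σr)
    (hσmin : 0 < σmin) (hγ₁ : 1 < γ₁) : ∀ i ≤ N, σmin ≤ σr i := by
  intro i
  induction i with
  | zero => exact fun _ => hrun.σr_zero.ge
  | succ i ih =>
    intro hi
    have h1 := ih (by omega)
    by_cases hρ : η < decreaseRatio f p (x i) (s i)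
    · rw [(hrun.successful i hi hρ).2]
      exact le_max_right _ _
    · rw [(hrun.unsuccessful i hi hρ).2, hrun.σ_eq i hi]
      have h2 : σmin ≤ max (σbar i) (σr i) := h1.trans (le_max_right _ _)
      nlinarith

theorem IsARpSosRun.regularization_le
    (hpk : (p = 3 ∧ k = 1) ∨ (p = 4 ∧ k = 2) ∨ (p = 5 ∧ k = 2))
    (hrun : IsARpSosRun f p ε a η γ₁ γ₂ σmin N x s σbar σ σr)
    (hL : 0 ≤ L) (hf : IsSmoothLip f p L) (hη1 : η < 1) (hγ₁ : 1 < γ₁)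
    (hγ₂1 : γ₂ < 1) (hσmin : 0 < σmin) (hε : 0 < ε) (hδ1 : ε ^ a ≤ 1)
    (hK : ∀ i ≤ N, ∀ j ∈ Finset.Icc 3 p, ‖iteratedFDeriv ℝ j f (x i)‖ ≤ K)
    (hB : 1 ≤ B) (hB₁ : K * n ≤ B) (hB₂ : K * n ^ 2 ≤ B) (hB₃ : K * n ^ 3 ≤ B) {Q C : ℝ}
    (hQ : Q = 6 * ((Nat.factorial (p - 1) : ℝ) * L) / (1 - η))
    (hC : C = σmin + 64 * B ^ 4 + γ₁ * (1 + Q + 16 * Q ^ 4)) :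
    ∀ i < N, σ i ≤ C / (ε ^ a) ^ (2 * k - 1) := by
  set δ := ε ^ a
  have hδ : 0 < δ := Real.rpow_pos_of_pos hε a
  have hη : 0 < 1 - η := by linarith
  have hQ0 : 0 ≤ Q := by rw [hQ]; positivity
  have hB0 : 0 ≤ 64 * B ^ 4 := by positivity
  have hQC : 0 ≤ γ₁ * (1 + Q + 16 * Q ^ 4) := by positivity
  have hdiv : ∀ c ≤ C, c / δ ^ (2 * k - 1) ≤ C / δ ^ (2 * k - 1) := fun c hc => by gcongr
  have hσr : ∀ i ≤ N, σr i ≤ C / δ ^ (2 * k - 1) → i < N → σ i ≤ C / δ ^ (2 * k - 1) := by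
    intro i hi h hiN
    rw [hrun.σ_eq i hiN]
    -- The smallest SoS-convex parameter is at most the explicit one.
    refine max_le (((hrun.σbar_min i hiN).2 ?_).trans (hdiv (64 * B ^ 4) (by linarith))) h
    exact isSosConvex_sosTaylorModel hpk hf (hK i hi) hB hB₁ hB₂ hB₃ hδ hδ1
  have hmin : σmin ≤ C / δ ^ (2 * k - 1) :=
    (le_div_pow_of_le hσmin.le hδ hδ1 _).trans (hdiv _ (by linarith))
  have key : ∀ i ≤ N, σr i ≤ C / δ ^ (2 * k - 1) := by
    intro i
    induction i with
    | zero => exact fun _ => hrun.σr_zero.le.trans hmin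
    | succ i ih =>
      intro hi
      have hσi := hσr i (by omega) (ih (by omega)) hi
      have hpos : 0 ≤ σ i := by
        rw [hrun.σ_eq i hi]
        exact hσmin.le.trans ((hrun.σmin_le hσmin hγ₁ i (by omega)).trans (le_max_right _ _))
      by_cases hρ : η < decreaseRatio f p (x i) (s i)
      · rw [(hrun.successful i hi hρ).2]
        refine max_le (le_trans ?_ hσi) hmin
        exact mul_le_of_le_one_left hpos hγ₂1.le
      · rw [(hrun.unsuccessful i hi hρ).2]
        have h1 := regularization_le_of_unsuccessful hpk hL hf hη1 hδ hδ1 hpos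
          (hrun.σbar_min i hi).1 (by rw [hrun.σ_eq i hi]; exact le_max_left _ _) (hrun.step i hi)
          (hε.trans (hrun.not_terminated i hi)) hρ hQ
        calc γ₁ * σ i ≤ γ₁ * ((1 + Q + 16 * Q ^ 4) / δ ^ (2 * k - 1)) := by gcongr
          _ = γ₁ * (1 + Q + 16 * Q ^ 4) / δ ^ (2 * k - 1) := by ring
          _ ≤ _ := hdiv _ (by linarith)
  exact fun i hi => hσr i hi.le (key i hi.le) hi

/-- In a successful iteration either the step is bounded below, or the shift of the Hessian
accounts for the decrease. -/
theorem IsARpSosRun.successful_decrease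
    (hpk : (p = 3 ∧ k = 1) ∨ (p = 4 ∧ k = 2) ∨ (p = 5 ∧ k = 2))
    (hrun : IsARpSosRun f p ε a η γ₁ γ₂ σmin N x s σbar σ σr)
    (hL : 0 ≤ L) (hf : IsSmoothLip f p L) (hη : 0 < η) (hγ₁ : 1 < γ₁) (hσmin : 0 < σmin)
    (hε : 0 < ε) (hε1 : ε < 1) {β C : ℝ} (hC : 0 ≤ C)
    (hβp : 1 ≤ β * p) (hβk : 1 + a * ((2 * k - 1 : ℕ) : ℝ) ≤ β * ((2 * k + 1 : ℕ) : ℝ))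
    {i : ℕ} (hi : i < N) (hσ : σ i ≤ C / (ε ^ a) ^ (2 * k - 1))
    (hρ : η < decreaseRatio f p (x i) (s i)) (hgrad : ε < ‖gradient f (x (i + 1))‖) :
    η * ((1 / (2 * ((Nat.factorial (p - 1) : ℝ) * L + C) + 1)) ^ 2 / 96) * ε ^ (a + 2 * β)
        ≤ f (x i) - f (x i + s i) ∨
      η * (ε ^ 2 / 8) ≤
        hessianShift (ε ^ a) (hessianMinEig f (x i)) * (f (x i) - f (x i + s i)) := by
  set δ := ε ^ a with hδdef
  set θ := hessianShift δ (hessianMinEig f (x i))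
  have hδ : 0 < δ := Real.rpow_pos_of_pos hε a
  have hθ : 0 ≤ θ := hessianShift_nonneg _ _
  have hσ0 : 0 ≤ σ i := by
    rw [hrun.σ_eq i hi]
    exact hσmin.le.trans ((hrun.σmin_le hσmin hγ₁ i hi.le).trans (le_max_right _ _))
  have hdec := taylorModel_decrease hpk hf (hrun.σbar_min i hi).1
    (by rw [hrun.σ_eq i hi]; exact le_max_left _ _) (hrun.step i hi)
  rw [(hrun.successful i hi hρ).1] at hgrad
  have hg := hgrad.le.trans (norm_gradient_step_le hpk hf hσ0 (hrun.step i hi))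
  set u := ‖s i‖
  have hu : 0 ≤ u := norm_nonneg _
  have h1 : δ / 96 * u ^ 2 + θ / 2 * u ^ 2 ≤ f (x i) - taylorModel f p (x i) (s i) := by
    have : 0 ≤ σ i / (2 * k + 2) * u ^ (2 * k + 2) := by positivity
    linarith
  have h2 : 0 ≤ δ / 96 * u ^ 2 := by positivity
  have h3 : 0 ≤ θ / 2 * u ^ 2 := by positivity
  -- A zero denominator would make the ratio 0 by convention, contradicting ratio > η > 0.
  have hF : 0 < f (x i) - taylorModel f p (x i) (s i) := by
    rcases (h2.trans ((le_add_of_nonneg_right h3).trans h1)).eq_or_lt with h0 | h0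
    · rw [decreaseRatio, ← h0, div_zero] at hρ
      linarith
    · exact h0
  rw [decreaseRatio, lt_div_iff₀ hF] at hρ
  rcases le_total (ε / 2) (θ * u) with h4 | h4
  · right
    have h5 : (ε / 2) ^ 2 ≤ (θ * u) ^ 2 := by gcongr
    calc η * (ε ^ 2 / 8) = η * ((ε / 2) ^ 2 / 2) := by ring
      _ ≤ η * ((θ * u) ^ 2 / 2) := by gcongr
      _ = θ * (η * (θ / 2 * u ^ 2)) := by ring
      _ ≤ θ * (η * (f (x i) - taylorModel f p (x i) (s i))) := by
        gcongr
        linarith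
      _ ≤ _ := by gcongr
  · left
    have h5 := step_lower_bound (by omega) (K := (Nat.factorial (p - 1) : ℝ) * L) (by positivity)
      hC hε hε1 hβp hβk hσ hu (by linarith)
    set c := 1 / (2 * ((Nat.factorial (p - 1) : ℝ) * L + C) + 1)
    have hc : 0 ≤ c := by positivity
    have h6 : (c * ε ^ β) ^ 2 ≤ u ^ 2 := by gcongr
    calc η * (c ^ 2 / 96) * ε ^ (a + 2 * β) = η * (δ / 96 * (c * ε ^ β) ^ 2) := by
          rw [Real.rpow_add hε, mul_comm 2 β, mul_pow, ← Real.rpow_natCast (ε ^ β),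
            ← Real.rpow_mul hε.le]
          push_cast
          ring
      _ ≤ η * (δ / 96 * u ^ 2) := by gcongr
      _ ≤ η * (f (x i) - taylorModel f p (x i) (s i)) := by
        gcongr
        linarith
      _ ≤ _ := hρ.le

end Run

end Algorithm

/-! ### The three curvature cases. -/

section Cases

variable {n : ℕ}

/-- Merges both alternatives into one bound when θ ≤ Mε^b. In the first, β ≤ 1 - a and b ≤ a give a
+ 2β ≤ 2 - a ≤ 2 - b. In the second, dividing ε² by θ leaves ε^(2-b)/M. -/
theorem decrease_of_alternative {Δ η ε a β c θ : ℝ} (hε : 0 < ε) (hε1 : ε < 1)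
    (hη : 0 < η) (hc : 0 ≤ c) (hc1 : c ≤ 1) (hβ : β ≤ 1 - a)
    (h : η * (c ^ 2 / 96) * ε ^ (a + 2 * β) ≤ Δ ∨ η * (ε ^ 2 / 8) ≤ θ * Δ)
    {M b : ℝ} (hM : 0 < M) (hθ : 0 ≤ θ) (hθM : θ ≤ M * ε ^ b) (hba : b ≤ a)
    (hM1 : 1 ≤ M) :
    η * (c / 8) ^ 2 / (2 * M) * ε ^ (2 - b) ≤ Δ := by
  have hpow : 0 < ε ^ (2 - b) := Real.rpow_pos_of_pos hε _
  rcases h with h | h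
  · refine le_trans ?_ h
    have h1 : ε ^ (2 - b) ≤ ε ^ (a + 2 * β) :=
      Real.rpow_le_rpow_of_exponent_ge hε hε1.le (by linarith)
    have h2 : η * (c / 8) ^ 2 / (2 * M) ≤ η * (c ^ 2 / 96) := by
      rw [div_le_iff₀ (by positivity)]
      have h3 : 0 ≤ η * c ^ 2 := by positivity
      nlinarith
    gcongr
  · have hΔ : 0 ≤ Δ := by
      by_contra! hlt
      have h1 : θ * Δ ≤ 0 := mul_nonpos_of_nonneg_of_nonpos hθ hlt.le
      have h2 : 0 < η * (ε ^ 2 / 8) := by positivity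
      linarith
    have h1 : η * (ε ^ 2 / 8) ≤ M * ε ^ b * Δ := h.trans (by gcongr)
    have h2 : ε ^ 2 = ε ^ (2 - b) * ε ^ b := by
      rw [← Real.rpow_add hε, sub_add_cancel, Real.rpow_two]
    have hb' : 0 < ε ^ b := Real.rpow_pos_of_pos hε _
    have h3 : η * (ε ^ (2 - b) / 8) ≤ M * Δ := by
      refine le_of_mul_le_mul_right ?_ hb'
      calc η * (ε ^ (2 - b) / 8) * ε ^ b = η * (ε ^ 2 / 8) := by rw [h2]; ring
        _ ≤ M * ε ^ b * Δ := h1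
        _ = _ := by ring
    rw [div_mul_eq_mul_div, div_le_iff₀ (by positivity)]
    have h4 : (c / 8) ^ 2 ≤ 1 / 64 := by
      rw [div_pow]
      have : c ^ 2 ≤ 1 := pow_le_one₀ hc hc1
      linarith
    calc η * (c / 8) ^ 2 * ε ^ (2 - b) ≤ η * (1 / 64) * ε ^ (2 - b) := by gcongr
      _ ≤ 2 * (η * (ε ^ (2 - b) / 8)) := by
        have : 0 < η * ε ^ (2 - b) := by positivity
        linarith
      _ ≤ Δ * (2 * M) := by linarith

/-- In the strongly convex case θ = 0 rules out the second alternative. The other cases use (M, b) =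
(Λ₂ + 1, 0) and (1, a). -/
theorem decrease_cases {Δ η ε a β c l Λ₂ : ℝ} (hε : 0 < ε) (hε1 : ε < 1) (ha : 0 ≤ a)
    (hη : 0 < η) (hc : 0 ≤ c) (hc1 : c ≤ 1) (hβ : β ≤ 1 - a) (hΛ₂ : 0 ≤ Λ₂) (hl : -Λ₂ ≤ l)
    (h : η * (c ^ 2 / 96) * ε ^ (a + 2 * β) ≤ Δ ∨
      η * (ε ^ 2 / 8) ≤ hessianShift (ε ^ a) l * Δ) :
    (ε ^ a ≤ l → η * (c ^ 2 / 96) * ε ^ (a + 2 * β) ≤ Δ) ∧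
    (l < 0 → η * (c / 8) ^ 2 / (2 * (Λ₂ + 1)) * ε ^ 2 ≤ Δ) ∧
    (0 ≤ l → l ≤ ε ^ a → η * (c / 8) ^ 2 / 2 * ε ^ (2 - a) ≤ Δ) := by
  have hδ : 0 < ε ^ a := Real.rpow_pos_of_pos hε a
  have hδ1 : ε ^ a ≤ 1 := Real.rpow_le_one hε.le hε1.le ha
  refine ⟨fun h1 => ?_, fun h1 => ?_, fun h1 _ => ?_⟩
  · refine h.resolve_right fun h2 => ?_
    rw [hessianShift, if_pos h1, zero_mul] at h2
    have : 0 < η * (ε ^ 2 / 8) := by positivity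
    linarith
  · have h2 := decrease_of_alternative hε hε1 hη hc hc1 hβ h (M := Λ₂ + 1) (b := 0)
      (by positivity) (hessianShift_nonneg _ _)
      (by
        rw [Real.rpow_zero, mul_one, hessianShift, if_neg (by linarith), if_pos h1.le]
        linarith)
      ha (by linarith)
    simpa using h2
  · have h2 := decrease_of_alternative hε hε1 hη hc hc1 hβ h (M := 1) (b := a)
      one_pos (hessianShift_nonneg _ _)
      (by
        rw [one_mul, hessianShift]
        split_ifs <;> linarith)
      le_rfl le_rfl
    simpa using h2

end Cases

end

/-! ### Choice of the constants and exponents. -/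

theorem mainTheorem4 (n p : ℕ) (hp3 : 3 ≤ p) (hp5 : p ≤ 5)
    (L : ℝ) (hL : 0 < L) (Λ : ℕ → ℝ)
    (η γ₁ σmin : ℝ) (hη0 : 0 < η) (hη1 : η < 1) (hγ₁ : 1 < γ₁) (hσmin : 0 < σmin) :
    ∃ c c₁ κ₃ κ₄ : ℝ, 0 < c ∧ 0 < c₁ ∧ 0 < κ₃ ∧ 0 < κ₄ ∧
      ∀ (γ₂ : ℝ), 0 < γ₂ → γ₂ < 1 →
      ∀ (f : Rn n → ℝ), IsSmoothLip f p L →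
      ∀ (a ε : ℝ), 0 ≤ a → a ≤ 1 / 2 → 0 < ε → ε < 1 →
      ∀ (N : ℕ) (x s : ℕ → Rn n) (σbar σ σr : ℕ → ℝ),
        IsARpSosRun f p ε a η γ₁ γ₂ σmin N x s σbar σ σr →
        (∀ k ≤ N, ∀ j ∈ Finset.Icc 1 p, ‖iteratedFDeriv ℝ j f (x k)‖ ≤ Λ j) →
        ∀ k < N, η < decreaseRatio f p (x k) (s k) →
          ε < ‖gradient f (x (k + 1))‖ →
          ((p = 3 ∨ p = 5) → ε ^ a ≤ hessianMinEig f (x k) →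
            η * c * ε ^ (a + 2 / (p : ℝ) * (1 + a * ((p : ℝ) - 2)))
              ≤ f (x k) - f (x k + s k)) ∧
          (p = 4 → ε ^ a ≤ hessianMinEig f (x k) →
            η * c₁ * ε ^ (a + 2 / ((p : ℝ) + 1) * (1 + max 1 (a * ((p : ℝ) - 1))))
              ≤ f (x k) - f (x k + s k)) ∧
          (hessianMinEig f (x k) < 0 →
            η * κ₃ ^ 2 / (2 * (Λ 2 + 1)) * ε ^ 2 ≤ f (x k) - f (x k + s k)) ∧
          (0 ≤ hessianMinEig f (x k) → hessianMinEig f (x k) ≤ ε ^ a →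
            η * κ₄ ^ 2 / 2 * ε ^ (2 - a) ≤ f (x k) - f (x k + s k)) ∧
          ((p = 3 ∨ p = 5) → a = 0 → 1 ≤ hessianMinEig f (x k) →
            η * c * ε ^ (2 / (p : ℝ)) ≤ f (x k) - f (x k + s k)) ∧
          (p = 4 → a = 0 → 1 ≤ hessianMinEig f (x k) →
            η * c₁ * ε ^ (4 / 5 : ℝ) ≤ f (x k) - f (x k + s k)) := by
  obtain ⟨m, hpm⟩ : ∃ m, (p = 3 ∧ m = 1) ∨ (p = 4 ∧ m = 2) ∨ (p = 5 ∧ m = 2) := by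
    interval_cases p <;> simp
  set K := |Λ 3| + |Λ 4| + |Λ 5| with hK
  have hK0 : 0 ≤ K := by positivity
  -- One B dominates 1 and all the counts Kn, Kn², Kn³, including n = 0.
  set B := 1 + K * (n + 1 : ℝ) ^ 3 with hB
  have hB1 : 1 ≤ B := by
    rw [hB]
    linarith [show 0 ≤ K * (n + 1 : ℝ) ^ 3 by positivity]
  have hKB : ∀ j ≤ 3, K * (n : ℝ) ^ j ≤ B := fun j hj => by
    have h1 : (n : ℝ) ^ j ≤ (n + 1 : ℝ) ^ 3 := by
      calc (n : ℝ) ^ j ≤ (n + 1 : ℝ) ^ j := by gcongr; linarith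
        _ ≤ (n + 1 : ℝ) ^ 3 := pow_le_pow_right₀ (by linarith [n.cast_nonneg (α := ℝ)]) hj
    have := mul_le_mul_of_nonneg_left h1 hK0
    linarith
  have hη' : 0 < 1 - η := by linarith
  obtain ⟨Q, hQ⟩ : ∃ Q, Q = 6 * ((Nat.factorial (p - 1) : ℝ) * L) / (1 - η) := ⟨_, rfl⟩
  have hQ0 : 0 ≤ Q := by rw [hQ]; positivity
  -- The summands cover the three sources of σ: the floor `σmin`, the SoS-convexity threshold, and
  -- one increase by `γ₁` after an unsuccessful iteration.
  obtain ⟨C, hC⟩ : ∃ C, C = σmin + 64 * B ^ 4 + γ₁ * (1 + Q + 16 * Q ^ 4) := ⟨_, rfl⟩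
  have hC0 : 0 ≤ C := by rw [hC]; positivity
  obtain ⟨c, hc⟩ : ∃ c, c = 1 / (2 * ((Nat.factorial (p - 1) : ℝ) * L + C) + 1) := ⟨_, rfl⟩
  have hc0 : 0 < c := by rw [hc]; positivity
  have hc1 : c ≤ 1 := by
    rw [hc, div_le_one (by positivity)]
    linarith [show 0 ≤ (Nat.factorial (p - 1) : ℝ) * L by positivity]
  refine ⟨c ^ 2 / 96, c ^ 2 / 96, c / 8, c / 8, by positivity, by positivity, by positivity,
    by positivity, ?_⟩
  intro γ₂ _ hγ₂1 f hf a ε ha ha2 hε hε1 N x s σbar σ σr hrun hΛ k hk hρ hgrad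
  have hΛK : ∀ i ≤ N, ∀ j ∈ Finset.Icc 3 p, ‖iteratedFDeriv ℝ j f (x i)‖ ≤ K := by
    intro i hi j hj
    rw [Finset.mem_Icc] at hj
    refine (hΛ i hi j (Finset.mem_Icc.2 ⟨by omega, hj.2⟩)).trans ?_
    have hj5 := hj.2.trans hp5
    have := hj.1
    interval_cases j <;>
      linarith [le_abs_self (Λ 3), le_abs_self (Λ 4), le_abs_self (Λ 5), abs_nonneg (Λ 3),
        abs_nonneg (Λ 4), abs_nonneg (Λ 5)]
  have hσ := hrun.regularization_le hpm hL.le hf hη1 hγ₁ hγ₂1 hσmin hε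
    (Real.rpow_le_one hε.le hε1.le ha) hΛK hB1 (by simpa using hKB 1 (by norm_num))
    (hKB 2 (by norm_num)) (hKB 3 le_rfl) hQ hC k hk
  have hΛ2 := hΛ k hk.le 2 (Finset.mem_Icc.2 ⟨by omega, by omega⟩)
  have hl : -Λ 2 ≤ hessianMinEig f (x k) :=
    (neg_le_neg hΛ2).trans (neg_norm_le_hessianMinEig (hf.isSymmForm (x k) 2 (by omega)))
  have key : ∀ β : ℝ, 1 ≤ β * p → 1 + a * ((2 * m - 1 : ℕ) : ℝ) ≤ β * ((2 * m + 1 : ℕ) : ℝ) →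
      β ≤ 1 - a → _ := fun β hβp hβm hβ =>
    decrease_cases hε hε1 ha hη0 hc0.le hc1 hβ ((norm_nonneg _).trans hΛ2) hl
      (hc ▸ hrun.successful_decrease hpm hL.le hf hη0 hγ₁ hσmin hε hε1 hC0 hβp hβm hk hσ hρ hgrad)
  -- For odd p, 2k + 1 = p and β = (1 + a(p-2))/p makes the second condition on β an equality; for p
  -- = 4, β = (1 + max{1, 3a})/5. In each case β ≤ 1 - a follows from a ≤ 1/2.
  rcases hpm with ⟨rfl, rfl⟩ | ⟨rfl, rfl⟩ | ⟨rfl, rfl⟩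
  · obtain ⟨h1, h2, h3⟩ := key ((1 + a) / 3) (by push_cast; linarith) (by norm_num) (by linarith)
    have e : a + 2 / ((3 : ℕ) : ℝ) * (1 + a * (((3 : ℕ) : ℝ) - 2)) = a + 2 * ((1 + a) / 3) := by
      push_cast; ring
    refine ⟨fun _ => e ▸ h1, fun h => by omega, h2, h3, ?_, fun h => by omega⟩
    rintro - rfl hl1
    have h4 := h1 (by simpa using hl1)
    norm_num at h4 ⊢
    exact h4
  · obtain ⟨h1, h2, h3⟩ := key ((1 + max 1 (a * 3)) / 5)
      (by push_cast; linarith [le_max_left 1 (a * 3)])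
      (by push_cast; linarith [le_max_right 1 (a * 3)])
      (by
        have : max 1 (a * 3) ≤ 4 - 5 * a := max_le (by linarith) (by linarith)
        linarith)
    have e : a + 2 / (((4 : ℕ) : ℝ) + 1) * (1 + max 1 (a * (((4 : ℕ) : ℝ) - 1)))
        = a + 2 * ((1 + max 1 (a * 3)) / 5) := by
      push_cast; norm_num; ring
    refine ⟨fun h => by omega, fun _ => e ▸ h1, h2, h3, fun h => by omega, ?_⟩
    rintro - rfl hl1
    have h4 := h1 (by simpa using hl1)
    norm_num at h4 ⊢
    exact h4
  · obtain ⟨h1, h2, h3⟩ := key ((1 + a * 3) / 5) (by push_cast; linarith) (by norm_num)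
      (by linarith)
    have e : a + 2 / ((5 : ℕ) : ℝ) * (1 + a * (((5 : ℕ) : ℝ) - 2))
        = a + 2 * ((1 + a * 3) / 5) := by
      push_cast; ring
    refine ⟨fun _ => e ▸ h1, fun h => by omega, h2, h3, ?_, fun h => by omega⟩
    rintro - rfl hl1
    have h4 := h1 (by simpa using hl1)
    norm_num at h4 ⊢
    exact h4
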